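/- Let $d\in\mathbb N$, $T>0$, and let $K:\mathbb R^d\to\mathbb R$ be a $C^1$ function with $\nabla K\in W^{1,\infty}(\mathbb R^d)$ (that is, $\nabla K$ and its weak derivative are in $L^\infty$). For a probability measure $\mu$ on $\mathbb R^d$ write $(\nabla K*\mu)(x)=\int\nabla K(x-y)\,d\mu(y)$. Let $\mathcal P(\mathbb R^k)$ be the set of Borel probability measures on $\mathbb R^k$, let $\mathcal P_1(\mathbb R^k)$ be the set of those with finite first moment, and let $W_1(\mu,\nu)=\inf_\pi\int|x-y|\,d\pi(x,y)$, the infimum over all couplings $\pi$ of $\mu$ and $\nu$. Let $f_0\in\mathcal P_1(\mathbb R^d\times\mathbb R^d)$ have compact support, and let $\rho_0$ be its first marginal. For each $\varepsilon>0$ let $f_\varepsilon\in C([0,T);\mathcal P_1(\mathbb R^d\times\mathbb R^d))$ (continuity in $W_1$), with first marginals $\rho_\varepsilon(t)$, be a measure solution with initial datum $f_0$ of the kinetic equation $$\partial_t f+v\cdot\nabla_x f=\tfrac1\varepsilon\nabla_v\cdot\big((v+\nabla K*\rho)f\big),\qquad \rho(t,\cdot)=\int f(t,\cdot,v)\,dv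 ,$$ which means: the field $\nabla K*\rho_\varepsilon(t)$ is locally Lipschitz in $x$, uniformly in $t$, and grows at most linearly in $x$, uniformly in $t$; and $f_\varepsilon(t)$ is the push-forward of $f_0$ by the time-$t$ flow map $(x(0),v(0))\mapsto(x(t),v(t))$ of $$\dot x=v,\qquad \dot v=-\tfrac1\varepsilon v-\tfrac1\varepsilon\,(\nabla K*\rho_\varepsilon(t))(x).$$ Then there is $\rho\in C([0,T);\mathcal P_1(\mathbb R^d))$ (continuity in $W_1$) such that, for each $t\in[0,T)$, $W_1(\rho_\varepsilon(t),\rho(t))\to0$ as $\varepsilon\to0^+$. Moreover, $\rho$ is the unique weak solution of $$\rho_t-\nabla\cdot\big((\nabla K*\rho)\rho\big)=0,\qquad \rho|_{t=0}=\rho_0 ,$$ where a weak solution is a narrowly continuous curve $\rho:[0,T)\to\mathcal P(\mathbb R^d)$ such that $$\int_0^T\!\!\int\partial_t\psi\,d\rho(t)\,dt-\int_0^T\!\!\int\nabla_x\psi\cdot(\nabla K*\rho(t))\,d\rho(t)\,dt+\int\psi(0,x)\,d\rho_0(x)=0$$ for every $\psi\in C^1_c([0,T);C^1_b(\mathbb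 R^d))$; uniqueness is in this whole class. -/

import Mathlib

open MeasureTheory Set Filter Topology
open scoped Gradient ENNReal BoundedContinuousFunction ContDiff

noncomputable section

namespace ZeroInertia

/-- The space `ℝ^d` with its Euclidean norm. -/
abbrev Space (d : ℕ) : Type := EuclideanSpace ℝ (Fin d)

section Wasserstein

variable {X : Type*} [NormedAddCommGroup X] [MeasurableSpace X]

/-- Membership in `𝒫₁(X)`: a probability measure with finite first moment. -/
def MemP1 (μ : ProbabilityMeasure X) : Prop :=
  ∫⁻ x, ‖x‖ₑ ∂(μ : Measure X) < (⊤ : ℝ≥0∞)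

/-- The couplings (transport plans) of `μ` and `ν`. -/
def couplings (μ ν : ProbabilityMeasure X) : Set (Measure (X × X)) :=
  {π | π.fst = (μ : Measure X) ∧ π.snd = (ν : Measure X)}

/-- The `1`-Wasserstein distance: the infimum of the transport cost `∫ |x - y| dπ(x, y)` over all
couplings `π`. -/
def W1 (μ ν : ProbabilityMeasure X) : ℝ≥0∞ :=
  ⨅ π ∈ couplings μ ν, ∫⁻ p, edist p.1 p.2 ∂π

/-- `μ ∈ C([0,T); 𝒫₁(X))`, with continuity for the distance `W1`. -/
def ContinuousInP1 (T : ℝ) (μ : ℝ → ProbabilityMeasure X) : Prop :=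
  (∀ t ∈ Ico 0 T, MemP1 (μ t)) ∧
    ∀ t ∈ Ico 0 T, Tendsto (fun s => W1 (μ s) (μ t)) (𝓝[Ico 0 T] t) (𝓝 0)

end Wasserstein

variable {d : ℕ}

/-- `DF` is the weak (distributional) derivative of `F` on `ℝ^d`. -/
def HasWeakDerivative (F : Space d → Space d) (DF : Space d → Space d →L[ℝ] Space d) : Prop :=
  ∀ φ : Space d → ℝ, ContDiff ℝ ∞ φ → HasCompactSupport φ → ∀ w : Space d,
    ∫ x, (fderiv ℝ φ x w) • F x = - ∫ x, φ x • DF x w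

/-- The vector field `F` belongs to `W^{1,∞}(ℝ^d)`. -/
def MemW1Infty (F : Space d → Space d) : Prop :=
  MemLp F ∞ volume ∧
    ∃ DF : Space d → Space d →L[ℝ] Space d, MemLp DF ∞ volume ∧ HasWeakDerivative F DF

/-- The convolution `(∇K ∗ μ)(x) = ∫ ∇K(x - y) dμ(y)`. -/
def gradConv (K : Space d → ℝ) (μ : ProbabilityMeasure (Space d)) (x : Space d) : Space d :=
  ∫ y, ∇ K (x - y) ∂(μ : Measure (Space d))

/-- The first marginal (macroscopic density) of a measure on the phase space `ℝ^d × ℝ^d`. -/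
def marginal (μ : ProbabilityMeasure (Space d × Space d)) : ProbabilityMeasure (Space d) :=
  μ.map measurable_fst.aemeasurable

/-- `Φ` is the flow on `[0,T)` of the characteristic system
`dx/dt = v`, `dv/dt = - v / ε - E(t,x) / ε`: for each `z = (x₀, v₀)`, the curve `t ↦ Φ t z` is the
solution that starts from `z` at `t = 0`. -/
def IsCharacteristicFlow (ε T : ℝ) (E : ℝ → Space d → Space d)
    (Φ : ℝ → Space d × Space d → Space d × Space d) : Prop :=
  ∀ z, Φ 0 z = z ∧ ∀ t ∈ Ico 0 T,
    HasDerivWithinAt (fun s => Φ s z)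
      ((Φ t z).2, -(1 / ε) • (Φ t z).2 - (1 / ε) • E t (Φ t z).1) (Ico 0 T) t

/-- `f ∈ C([0,T); 𝒫₁(ℝ^d × ℝ^d))` is a measure solution, in the mass transportation sense, of the
kinetic equation `f_t + v · ∇ₓ f = (1/ε) ∇ᵥ · ((v + ∇K ∗ ρ) f)` with initial measure `f₀`, where `ρ`
is the first marginal of `f`: the field `E = ∇K ∗ ρ` is locally Lipschitz in `x` and grows at most
linearly, and `f t` is the push-forward of `f₀` by the flow of the characteristic system. -/
structure IsMeasureSolution (K : Space d → ℝ) (ε T : ℝ)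
    (f₀ : ProbabilityMeasure (Space d × Space d))
    (f : ℝ → ProbabilityMeasure (Space d × Space d)) : Prop where
  continuousInP1 : ContinuousInP1 T f
  locally_lipschitz : ∀ S : Set (Space d), IsCompact S → ∃ L, ∀ t ∈ Ico 0 T,
    LipschitzOnWith L (gradConv K (marginal (f t))) S
  linear_growth : ∃ C : ℝ, 0 < C ∧ ∀ t ∈ Ico 0 T, ∀ x,
    ‖gradConv K (marginal (f t)) x‖ ≤ C * (1 + ‖x‖)
  transport : ∃ Φ : ℝ → Space d × Space d → Space d × Space d,
    IsCharacteristicFlow ε T (fun t => gradConv K (marginal (f t))) Φ ∧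
    ∀ t ∈ Ico 0 T, AEMeasurable (Φ t) (f₀ : Measure (Space d × Space d)) ∧
      (f t : Measure (Space d × Space d)) = (f₀ : Measure (Space d × Space d)).map (Φ t)

/-- A test function `ψ ∈ C¹_c([0,T); C¹_b(ℝ^d))`. A function in `C¹_b` is recorded together with its
gradient, both in the Banach space of bounded continuous functions with the supremum norm, so that
the `C¹_b` norm is that of the pair `(val t, grad t)`. -/
structure TestFun (d : ℕ) (T : ℝ) where
  /-- the function `ψ(t, ·)` -/
  val : ℝ → (Space d →ᵇ ℝ)
  /-- the spatial gradient `∇ₓψ(t, ·)` -/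
  grad : ℝ → (Space d →ᵇ Space d)
  hasGradientAt : ∀ t ∈ Ico 0 T, ∀ x, HasGradientAt (val t) (grad t x) x
  contDiffOn_val : ContDiffOn ℝ 1 val (Ico 0 T)
  contDiffOn_grad : ContDiffOn ℝ 1 grad (Ico 0 T)
  compact_support : ∃ τ < T, ∀ t ∈ Ico 0 T, τ < t → val t = 0

/-- The time derivative `∂ₜψ(t, ·)` (one-sided at `t = 0`). -/
def TestFun.timeDeriv {T : ℝ} (ψ : TestFun d T) (t : ℝ) : Space d →ᵇ ℝ :=
  derivWithin ψ.val (Ico 0 T) t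

/-- `ρ ∈ C([0,T); 𝒫(ℝ^d))`, with narrow continuity in time, is a weak solution of
`ρ_t - ∇ · ((∇K ∗ ρ) ρ) = 0` with initial measure `ρ₀`. -/
structure IsWeakSolution (K : Space d → ℝ) (T : ℝ) (ρ₀ : ProbabilityMeasure (Space d))
    (ρ : ℝ → ProbabilityMeasure (Space d)) : Prop where
  narrow_continuous : ContinuousOn ρ (Ico 0 T)
  weak_form : ∀ ψ : TestFun d T,
    (∫ t in (0 : ℝ)..T, ∫ x, ψ.timeDeriv t x ∂(ρ t : Measure (Space d)))
      - (∫ t in (0 : ℝ)..T, ∫ x, inner ℝ (ψ.grad t x) (gradConv K (ρ t) x)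
          ∂(ρ t : Measure (Space d)))
      + ∫ x, ψ.val 0 x ∂(ρ₀ : Measure (Space d)) = 0

end ZeroInertia

end

open ZeroInertia

noncomputable section

namespace ZeroInertia

variable {d : ℕ}

/-! The continuous field `∇ K` has a bounded weak derivative, so it is bounded by some M, Lipschitz
with some constant L, and a uniform limit of C¹ fields with the same bounds
(`MemW1Infty.exists_isRegularKernel`). Everything else rests on this.

Existence of the limit is by characteristics. With the flow written as X = id + u, the mean field
equation becomes an autonomous ODE for u in the Banach space of bounded continuous maps, whose
right-hand side is bounded and globally Lipschitz (`exists_isMeanFieldFlow`).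

Convergence uses the slow variable x + εv, whose time derivative is exactly -(∇K ∗ ρ_ε)(x). Damping
keeps |v| ≤ |v₀| + M uniformly in ε, so x - X is O(ε) plus the time integral of a force difference,
which is itself Lipschitz in the deviation. A Gronwall argument for the supremum over the support of
f₀ gives |x - X| = O(ε) (`norm_sub_flow_le_mul_exp`). Both densities are images of f₀, and this
common source is a coupling that bounds `W1`.

Uniqueness has to cover curves that are merely narrowly continuous, with no moments and no flow
representation. Two solutions are compared in duality with C¹_b functions of gradient at most one.
Over a short interval [s, t] both are compared with the same explicit Euler step along a smoothed
field frozen at time s (`IsWeakSolution.abs_integral_sub_transport_le`). Composition with that step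
enlarges the gradient bound of a test function by at most 1 + L(t - s); freezing the field costs
O((t - s)²) plus L(t - s) times the distance at time s. The resulting inequality
`IsWeakSolution.dualDist_step` closes by Gronwall. -/

/-- A force field that is bounded by `M`, Lipschitz with constant `L`, and a uniform limit of `C¹`
fields with the same bounds. -/
structure IsRegularKernel (F : Space d → Space d) (M L : ℝ) : Prop where
  lipschitz_pos : 0 < L
  norm_le : ∀ x, ‖F x‖ ≤ M
  norm_sub_le : ∀ x y, ‖F x - F y‖ ≤ L * ‖x - y‖
  approx : ∀ δ > 0, ∃ G : Space d → Space d, ContDiff ℝ 1 G ∧ (∀ x, ‖G x‖ ≤ M) ∧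
    (∀ x, ‖fderiv ℝ G x‖ ≤ L) ∧ ∀ x, ‖G x - F x‖ ≤ δ

lemma IsRegularKernel.bound_nonneg {F : Space d → Space d} {M L : ℝ} (h : IsRegularKernel F M L) :
    0 ≤ M := (norm_nonneg _).trans (h.norm_le 0)

lemma IsRegularKernel.continuous {F : Space d → Space d} {M L : ℝ} (h : IsRegularKernel F M L) :
    Continuous F :=
  (LipschitzWith.of_dist_le_mul (K := L.toNNReal) fun x y => by
    rw [dist_eq_norm, dist_eq_norm, Real.coe_toNNReal _ h.lipschitz_pos.le]
    exact h.norm_sub_le x y).continuous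

lemma ae_norm_le_of_memLp_top {E G : Type*} [MeasurableSpace E] [NormedAddCommGroup G]
    {μ : Measure E} {F : E → G} (h : MemLp F ∞ μ) : ∀ᵐ x ∂μ, ‖F x‖ ≤ (eLpNorm F ∞ μ).toReal := by
  have h1 := ae_le_eLpNormEssSup (f := F) (μ := μ)
  filter_upwards [h1] with x hx
  rw [← eLpNorm_exponent_top] at hx
  have := ENNReal.toReal_mono h.2.ne hx
  simpa using this

lemma norm_le_of_ae_norm_le {E G : Type*} [TopologicalSpace E] [MeasurableSpace E]
    [NormedAddCommGroup G] {μ : Measure E} [μ.IsOpenPosMeasure] {F : E → G} (hF : Continuous F)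
    {M : ℝ} (h : ∀ᵐ x ∂μ, ‖F x‖ ≤ M) (x : E) : ‖F x‖ ≤ M := by
  have h1 : Dense {x | ‖F x‖ ≤ M} := Measure.dense_of_ae h
  have h2 : IsClosed {x | ‖F x‖ ≤ M} := isClosed_le hF.norm continuous_const
  have := h1 x
  rwa [h2.closure_eq] at this

/-! ### Mollification: from a bounded weak derivative to a Lipschitz field. -/

section Mollification

variable {F : Space d → Space d} {DF : Space d → Space d →L[ℝ] Space d} {M L : ℝ}

/-- The mollification of a vector field by a normed bump function. -/
def mollify (φ : ContDiffBump (0 : Space d)) (F : Space d → Space d) : Space d → Space d :=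
  convolution (φ.normed volume) F (ContinuousLinearMap.lsmul ℝ ℝ) volume

lemma contDiff_mollify (φ : ContDiffBump (0 : Space d)) (hF : Continuous F) :
    ContDiff ℝ 1 (mollify φ F) :=
  φ.hasCompactSupport_normed.contDiff_convolution_left (n := 1) _ φ.contDiff_normed
    hF.locallyIntegrable

lemma norm_integral_smul_bump_le {G : Space d → Space d} (φ : ContDiffBump (0 : Space d))
    (hG : ∀ᵐ y, ‖G y‖ ≤ M) (x : Space d) :
    ‖∫ y, φ.normed volume (x - y) • G y‖ ≤ M := by
  have hint : Integrable (fun y => φ.normed volume (x - y)) :=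
    (φ.integrable_normed (μ := volume)).comp_sub_left x
  calc ‖∫ y, φ.normed volume (x - y) • G y‖ ≤ ∫ y, φ.normed volume (x - y) * M := by
        refine norm_integral_le_of_norm_le (hint.mul_const M) ?_
        filter_upwards [hG] with y hy
        rw [norm_smul, Real.norm_of_nonneg (φ.nonneg_normed _)]
        exact mul_le_mul_of_nonneg_left hy (φ.nonneg_normed _)
    _ = M := by
        rw [integral_mul_const, integral_sub_left_eq_self (φ.normed volume) volume x,
          φ.integral_normed, one_mul]

lemma mollify_eq (φ : ContDiffBump (0 : Space d)) (F : Space d → Space d) (x : Space d) :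
    mollify φ F x = ∫ y, φ.normed volume (x - y) • F y := by
  rw [mollify, convolution_def, ← integral_sub_left_eq_self _ _ x]
  simp

lemma norm_mollify_le (φ : ContDiffBump (0 : Space d)) (hF : ∀ x, ‖F x‖ ≤ M) (x : Space d) :
    ‖mollify φ F x‖ ≤ M := by
  rw [mollify_eq]
  exact norm_integral_smul_bump_le φ (.of_forall hF) x

/-- The weak derivative is tested against y ↦ φ(x - y); the sign of the reflection cancels the sign
of the integration by parts. -/
lemma fderiv_mollify_apply (φ : ContDiffBump (0 : Space d)) (hF : Continuous F)
    (hDF : HasWeakDerivative F DF) (x w : Space d) :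
    fderiv ℝ (mollify φ F) x w = ∫ y, φ.normed volume (x - y) • DF y w := by
  have hφ : ContDiff ℝ 1 (φ.normed volume) := φ.contDiff_normed
  have h1 := φ.hasCompactSupport_normed.hasFDerivAt_convolution_left
    (ContinuousLinearMap.lsmul ℝ ℝ) hφ hF.locallyIntegrable (μ := volume) x
  have hcomp : ∀ y, fderiv ℝ (fun y => φ.normed volume (x - y)) y w
      = - fderiv ℝ (φ.normed volume) (x - y) w := by
    intro y
    have h2 : HasFDerivAt (fun y => φ.normed volume (x - y))
        ((fderiv ℝ (φ.normed volume) (x - y)).comp (-ContinuousLinearMap.id ℝ (Space d))) y :=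
      HasFDerivAt.comp y (hφ.differentiable one_ne_zero _).hasFDerivAt
        ((hasFDerivAt_id y).const_sub x)
    rw [h2.fderiv]; simp
  have h3 := hDF (fun y => φ.normed volume (x - y))
    (φ.contDiff_normed.comp (contDiff_const.sub contDiff_id))
    (φ.hasCompactSupport_normed.comp_homeomorph (Homeomorph.subLeft x)) w
  simp_rw [hcomp, neg_smul, integral_neg, neg_inj] at h3
  rw [mollify, h1.fderiv, ← h3,
    convolution_def, ContinuousLinearMap.integral_apply, ← integral_sub_left_eq_self _ _ x]
  · simp [ContinuousLinearMap.precompL_apply]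
  · exact (φ.hasCompactSupport_normed.fderiv ℝ).convolutionExists_left _
      (hφ.continuous_fderiv one_ne_zero) hF.locallyIntegrable x

lemma norm_fderiv_mollify_le (φ : ContDiffBump (0 : Space d)) (hF : Continuous F) (hL : 0 ≤ L)
    (hDF : HasWeakDerivative F DF) (hDFL : ∀ᵐ x, ‖DF x‖ ≤ L) (x : Space d) :
    ‖fderiv ℝ (mollify φ F) x‖ ≤ L := by
  refine ContinuousLinearMap.opNorm_le_bound _ hL fun w => ?_
  rw [fderiv_mollify_apply φ hF hDF]
  refine norm_integral_smul_bump_le φ ?_ x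
  filter_upwards [hDFL] with y hy
  exact (DF y).le_of_opNorm_le hy w

lemma norm_mollify_sub_mollify_le (φ : ContDiffBump (0 : Space d)) (hF : Continuous F) (hL : 0 ≤ L)
    (hDF : HasWeakDerivative F DF) (hDFL : ∀ᵐ x, ‖DF x‖ ≤ L) (x y : Space d) :
    ‖mollify φ F x - mollify φ F y‖ ≤ L * ‖x - y‖ :=
  convex_univ.norm_image_sub_le_of_norm_fderiv_le
    (fun z _ => (contDiff_mollify φ hF).differentiable one_ne_zero z)
    (fun z _ => norm_fderiv_mollify_le φ hF hL hDF hDFL z) (mem_univ _) (mem_univ _)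

lemma exists_mollify_near (hF : Continuous F) (x y : Space d) {ε : ℝ} (hε : 0 < ε) :
    ∃ φ : ContDiffBump (0 : Space d), ‖mollify φ F x - F x‖ ≤ ε ∧ ‖mollify φ F y - F y‖ ≤ ε := by
  obtain ⟨r, hr, hrx⟩ := Metric.continuousAt_iff.1 (hF.continuousAt (x := x)) ε hε
  obtain ⟨s, hs, hsy⟩ := Metric.continuousAt_iff.1 (hF.continuousAt (x := y)) ε hε
  let φ : ContDiffBump (0 : Space d) := ⟨min r s / 2, min r s, by positivity, by
    have : 0 < min r s := by positivity
    linarith⟩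
  refine ⟨φ, ?_, ?_⟩ <;> rw [← dist_eq_norm]
  · exact φ.dist_normed_convolution_le hF.aestronglyMeasurable fun z hz =>
      (hrx (lt_of_lt_of_le (Metric.mem_ball.1 hz) (min_le_left _ _))).le
  · exact φ.dist_normed_convolution_le hF.aestronglyMeasurable fun z hz =>
      (hsy (lt_of_lt_of_le (Metric.mem_ball.1 hz) (min_le_right _ _))).le

/-- A continuous vector field with a bounded weak derivative is Lipschitz. -/
lemma norm_sub_le_of_hasWeakDerivative (hF : Continuous F) (hL : 0 ≤ L)
    (hDF : HasWeakDerivative F DF) (hDFL : ∀ᵐ x, ‖DF x‖ ≤ L) (x y : Space d) :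
    ‖F x - F y‖ ≤ L * ‖x - y‖ := by
  refine le_of_forall_pos_le_add fun ε hε => ?_
  obtain ⟨φ, hx, hy⟩ := exists_mollify_near hF x y (half_pos hε)
  have h := norm_mollify_sub_mollify_le φ hF hL hDF hDFL x y
  calc ‖F x - F y‖ = ‖(mollify φ F x - mollify φ F y) - (mollify φ F x - F x)
        + (mollify φ F y - F y)‖ := by congr 1; abel
    _ ≤ ‖mollify φ F x - mollify φ F y‖ + ‖mollify φ F x - F x‖ + ‖mollify φ F y - F y‖ :=
        (norm_add_le _ _).trans (by gcongr; exact norm_sub_le _ _)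
    _ ≤ L * ‖x - y‖ + ε := by linarith

lemma MemW1Infty.exists_isRegularKernel (hF : Continuous F) (h : MemW1Infty F) :
    ∃ M L, IsRegularKernel F M L := by
  obtain ⟨hF', DF, hDF', hDF⟩ := h
  -- The added 1 makes L positive, so that a bump of radius δ / L can be used below: by the
  -- Lipschitz bound it moves F by at most δ, uniformly in x.
  set L := (eLpNorm DF ∞ volume).toReal + 1
  have hL : 0 < L := by positivity
  have hb := norm_le_of_ae_norm_le hF (ae_norm_le_of_memLp_top hF')
  have hDFL : ∀ᵐ x, ‖DF x‖ ≤ L := by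
    filter_upwards [ae_norm_le_of_memLp_top hDF'] with x hx
    linarith
  have hlip := norm_sub_le_of_hasWeakDerivative hF hL.le hDF hDFL
  refine ⟨_, L, hL, hb, hlip, fun δ hδ => ?_⟩
  let φ : ContDiffBump (0 : Space d) := ⟨δ / L / 2, δ / L, by positivity, by
    have : 0 < δ / L := by positivity
    linarith⟩
  refine ⟨mollify φ F, contDiff_mollify φ hF, norm_mollify_le φ hb,
    norm_fderiv_mollify_le φ hF hL.le hDF hDFL, fun x => ?_⟩
  rw [← dist_eq_norm]
  refine φ.dist_normed_convolution_le hF.aestronglyMeasurable fun z hz => ?_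
  rw [dist_eq_norm]
  refine (hlip z x).trans ?_
  have : ‖z - x‖ ≤ δ / L := by rw [← dist_eq_norm]; exact (Metric.mem_ball.1 hz).le
  calc L * ‖z - x‖ ≤ L * (δ / L) := by gcongr
    _ = δ := by field_simp

end Mollification

variable {K : Space d → ℝ} {M L T ε : ℝ}

/-! ### Bounds and stability for the mean field ∇K ∗ μ. -/

section Convolution

variable (h : IsRegularKernel (∇ K) M L)

include h

lemma IsRegularKernel.integrable {Ω : Type*} [MeasurableSpace Ω] {μ : Measure Ω}
    [IsFiniteMeasure μ] {g : Ω → Space d} (hg : AEMeasurable g μ) :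
    Integrable (fun z => ∇ K (g z)) μ :=
  Integrable.of_bound (h.continuous.measurable.comp_aemeasurable hg).aestronglyMeasurable M
    (.of_forall fun _ => h.norm_le _)

lemma norm_gradConv_le (μ : ProbabilityMeasure (Space d)) (x : Space d) :
    ‖gradConv K μ x‖ ≤ M := by
  rw [gradConv]
  simpa using norm_integral_le_of_norm_le_const (μ := (μ : Measure (Space d)))
    (.of_forall fun y => h.norm_le (x - y))

lemma gradConv_map {Ω : Type*} [MeasurableSpace Ω] {P : Measure Ω} {g : Ω → Space d}
    (hg : AEMeasurable g P) {μ : ProbabilityMeasure (Space d)} (hμ : (μ : Measure _) = P.map g)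
    (x : Space d) : gradConv K μ x = ∫ z, ∇ K (x - g z) ∂P := by
  rw [gradConv, hμ, integral_map hg]
  exact (h.continuous.comp (by fun_prop)).aestronglyMeasurable

/-- Stability of the convolution under a joint perturbation of the point and of the measure. -/
lemma norm_gradConv_sub_gradConv_le {Ω : Type*} [MeasurableSpace Ω] {P : Measure Ω}
    [IsProbabilityMeasure P] {g g' : Ω → Space d} (hg : AEMeasurable g P) (hg' : AEMeasurable g' P)
    {μ μ' : ProbabilityMeasure (Space d)} (hμ : (μ : Measure _) = P.map g)
    (hμ' : (μ' : Measure _) = P.map g') {D : ℝ} (hD : ∀ᵐ z ∂P, ‖g z - g' z‖ ≤ D)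
    (x x' : Space d) : ‖gradConv K μ x - gradConv K μ' x'‖ ≤ L * (‖x - x'‖ + D) := by
  rw [gradConv_map h hg hμ, gradConv_map h hg' hμ', ← integral_sub
    (h.integrable (g := fun z => x - g z) (by fun_prop))
    (h.integrable (g := fun z => x' - g' z) (by fun_prop))]
  have : ∀ᵐ z ∂P, ‖∇ K (x - g z) - ∇ K (x' - g' z)‖ ≤ L * (‖x - x'‖ + D) := by
    filter_upwards [hD] with z hz
    refine (h.norm_sub_le _ _).trans (mul_le_mul_of_nonneg_left ?_ h.lipschitz_pos.le)
    calc ‖x - g z - (x' - g' z)‖ = ‖(x - x') - (g z - g' z)‖ := by congr 1; abel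
      _ ≤ ‖x - x'‖ + D := (norm_sub_le _ _).trans (by gcongr)
  simpa using norm_integral_le_of_norm_le_const this

lemma norm_gradConv_sub_le (μ : ProbabilityMeasure (Space d)) (x x' : Space d) :
    ‖gradConv K μ x - gradConv K μ x'‖ ≤ L * ‖x - x'‖ := by
  simpa using norm_gradConv_sub_gradConv_le h (P := (μ : Measure (Space d))) (D := 0)
    aemeasurable_id aemeasurable_id (μ := μ) (μ' := μ) (by simp) (by simp) (by simp) x x'

lemma continuous_gradConv (μ : ProbabilityMeasure (Space d)) : Continuous (gradConv K μ) :=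
  (LipschitzWith.of_dist_le_mul (K := L.toNNReal) fun x y => by
    rw [dist_eq_norm, dist_eq_norm, Real.coe_toNNReal _ h.lipschitz_pos.le]
    exact norm_gradConv_sub_le h μ x y).continuous

end Convolution

/-! ### Construction of the limit flow. -/

section Flow

lemma continuous_id_add (u : Space d →ᵇ Space d) : Continuous fun x => x + u x := by fun_prop

/-- The image of a measure under the displacement `x ↦ x + u x`. -/
def displaced (ρ₀ : ProbabilityMeasure (Space d)) (u : Space d →ᵇ Space d) :
    ProbabilityMeasure (Space d) :=
  ρ₀.map (continuous_id_add u).measurable.aemeasurable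

/-- The velocity of the displacement `u` in the mean field of the displaced measure. -/
def displacementVelocity (h : IsRegularKernel (∇ K) M L) (ρ₀ : ProbabilityMeasure (Space d))
    (u : Space d →ᵇ Space d) : Space d →ᵇ Space d :=
  BoundedContinuousFunction.ofNormedAddCommGroup
    (fun x => -gradConv K (displaced ρ₀ u) (x + u x))
    ((continuous_gradConv h _).comp (continuous_id_add u)).neg M
    (fun x => by rw [norm_neg]; exact norm_gradConv_le h _ _)

lemma displacementVelocity_apply (h : IsRegularKernel (∇ K) M L)
    (ρ₀ : ProbabilityMeasure (Space d)) (u : Space d →ᵇ Space d) (x : Space d) :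
    displacementVelocity h ρ₀ u x = -gradConv K (displaced ρ₀ u) (x + u x) := rfl

/-- A change of u moves both the evaluation point and the transported measure by at most ‖u - w‖;
each contributes one L. -/
lemma lipschitzWith_displacementVelocity (h : IsRegularKernel (∇ K) M L)
    (ρ₀ : ProbabilityMeasure (Space d)) :
    LipschitzWith (2 * L).toNNReal (displacementVelocity h ρ₀) := by
  have hL := h.lipschitz_pos
  refine LipschitzWith.of_dist_le_mul fun u w => ?_
  rw [dist_eq_norm, dist_eq_norm, Real.coe_toNNReal _ (by positivity)]
  refine (BoundedContinuousFunction.norm_le (by positivity)).2 fun x => ?_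
  have hb : ∀ y, ‖(y + u y) - (y + w y)‖ ≤ ‖u - w‖ := fun y => by
    rw [add_sub_add_left_eq_sub]; exact (u - w).norm_coe_le_norm y
  have := norm_gradConv_sub_gradConv_le h (P := (ρ₀ : Measure (Space d)))
    (continuous_id_add u).measurable.aemeasurable (continuous_id_add w).measurable.aemeasurable
    (μ := displaced ρ₀ u) (μ' := displaced ρ₀ w) (ProbabilityMeasure.toMeasure_map _ _)
    (ProbabilityMeasure.toMeasure_map _ _) (.of_forall hb) (x + u x) (x + w x)
  rw [BoundedContinuousFunction.sub_apply, displacementVelocity_apply, displacementVelocity_apply,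
    neg_sub_neg, norm_sub_rev]
  nlinarith [hb x]

/-- `X` is the flow of the mean field equation `∂ₜX = -(∇K ∗ ρ)(X)` on `[0,T]`, where `ρ` is the
push-forward of `ρ₀` under `X`. -/
structure IsMeanFieldFlow (K : Space d → ℝ) (T : ℝ) (ρ₀ : ProbabilityMeasure (Space d))
    (X : ℝ → Space d → Space d) (ρ : ℝ → ProbabilityMeasure (Space d)) : Prop where
  continuous : ∀ t, Continuous (X t)
  initial : ∀ x, X 0 x = x
  hasDerivAt : ∀ t ∈ Icc 0 T, ∀ x, HasDerivAt (fun s => X s x) (-gradConv K (ρ t) (X t x)) t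
  map_eq : ∀ t, (ρ t : Measure (Space d)) = (ρ₀ : Measure (Space d)).map (X t)

lemma exists_isMeanFieldFlow (h : IsRegularKernel (∇ K) M L) (hT : 0 < T)
    (ρ₀ : ProbabilityMeasure (Space d)) : ∃ X ρ, IsMeanFieldFlow K T ρ₀ X ρ := by
  have hM := h.bound_nonneg
  -- The time interval is padded on both sides so that two-sided derivatives exist on all of [0, T].
  -- The field is bounded by M everywhere, so the ball of radius M(T + 1) is never left and no
  -- smallness of T is needed.
  have hpl : IsPicardLindelof (fun _ : ℝ => displacementVelocity h ρ₀) (tmin := -1) (tmax := T + 1)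
      ⟨0, by constructor <;> linarith⟩ 0 (M * (T + 1)).toNNReal 0 M.toNNReal (2 * L).toNNReal := by
    refine ⟨fun t _ => (lipschitzWith_displacementVelocity h ρ₀).lipschitzOnWith,
      fun _ _ => continuousOn_const, fun t _ u _ => ?_, ?_⟩
    · rw [Real.coe_toNNReal _ hM]
      refine (BoundedContinuousFunction.norm_le hM).2 fun x => ?_
      rw [displacementVelocity_apply, norm_neg]
      exact norm_gradConv_le h _ _
    · have : 0 ≤ M * (T + 1) := by positivity
      rw [Real.coe_toNNReal _ hM, Real.coe_toNNReal _ this]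
      simp [max_eq_left (show (1 : ℝ) ≤ T + 1 by linarith)]
  obtain ⟨u, hu0, hu⟩ := hpl.exists_eq_forall_mem_Icc_hasDerivWithinAt₀
  refine ⟨fun t x => x + u t x, fun t => displaced ρ₀ (u t), fun t => continuous_id_add _,
    fun x => ?_, fun t ht x => ?_, fun t => ProbabilityMeasure.toMeasure_map _ _⟩
  · have : u 0 = 0 := hu0
    simp [this]
  · have h1 : HasDerivAt u (displacementVelocity h ρ₀ (u t)) t :=
      (hu t ⟨by linarith [ht.1], by linarith [ht.2]⟩).hasDerivAt
        (Icc_mem_nhds (by linarith [ht.1]) (by linarith [ht.2]))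
    exact ((BoundedContinuousFunction.evalCLM ℝ x).hasFDerivAt.comp_hasDerivAt t h1).const_add x

end Flow

/-! ### Regularity of the limit curve in `W1`. -/

section FlowProperties

variable {ρ₀ : ProbabilityMeasure (Space d)} {X : ℝ → Space d → Space d}
  {ρ : ℝ → ProbabilityMeasure (Space d)}

lemma IsMeanFieldFlow.norm_sub_le (hX : IsMeanFieldFlow K T ρ₀ X ρ)
    (h : IsRegularKernel (∇ K) M L) {s t : ℝ} (hs : s ∈ Icc 0 T) (ht : t ∈ Icc 0 T) (x : Space d) :
    ‖X t x - X s x‖ ≤ M * |t - s| :=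
  (convex_Icc 0 T).norm_image_sub_le_of_norm_hasDerivWithin_le
    (fun r hr => (hX.hasDerivAt r hr x).hasDerivWithinAt)
    (fun r _ => by rw [norm_neg]; exact norm_gradConv_le h _ _) hs ht

/-- The joint law of g and g' under P is a coupling of the two images. -/
lemma W1_le_lintegral {Ω E : Type*} [MeasurableSpace Ω] [NormedAddCommGroup E] [MeasurableSpace E]
    [BorelSpace E] [SecondCountableTopology E] {P : Measure Ω} {g g' : Ω → E}
    (hg : AEMeasurable g P) (hg' : AEMeasurable g' P) {μ μ' : ProbabilityMeasure E}
    (hμ : (μ : Measure E) = P.map g) (hμ' : (μ' : Measure E) = P.map g') :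
    W1 μ μ' ≤ ∫⁻ z, edist (g z) (g' z) ∂P := by
  have hc : P.map (fun z => (g z, g' z)) ∈ couplings μ μ' := by
    constructor
    · rw [Measure.fst, AEMeasurable.map_map_of_aemeasurable measurable_fst.aemeasurable
        (hg.prodMk hg'), hμ]; rfl
    · rw [Measure.snd, AEMeasurable.map_map_of_aemeasurable measurable_snd.aemeasurable
        (hg.prodMk hg'), hμ']; rfl
  refine (iInf₂_le _ hc).trans_eq ?_
  rw [lintegral_map' measurable_edist.aemeasurable (hg.prodMk hg')]

lemma W1_le_of_norm_sub_le {Ω E : Type*} [MeasurableSpace Ω] [NormedAddCommGroup E]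
    [MeasurableSpace E] [BorelSpace E] [SecondCountableTopology E] {P : Measure Ω}
    [IsProbabilityMeasure P] {g g' : Ω → E}
    (hg : AEMeasurable g P) (hg' : AEMeasurable g' P) {μ μ' : ProbabilityMeasure E}
    (hμ : (μ : Measure E) = P.map g) (hμ' : (μ' : Measure E) = P.map g') {D : ℝ}
    (hD : ∀ᵐ z ∂P, ‖g z - g' z‖ ≤ D) : W1 μ μ' ≤ ENNReal.ofReal D := by
  refine (W1_le_lintegral hg hg' hμ hμ').trans ?_
  calc ∫⁻ z, edist (g z) (g' z) ∂P ≤ ∫⁻ _, ENNReal.ofReal D ∂P := by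
        refine lintegral_mono_ae ?_
        filter_upwards [hD] with z hz
        rw [edist_dist, dist_eq_norm]
        exact ENNReal.ofReal_le_ofReal hz
    _ = ENNReal.ofReal D := by simp

lemma IsMeanFieldFlow.memP1 (hX : IsMeanFieldFlow K T ρ₀ X ρ) (h : IsRegularKernel (∇ K) M L)
    (hρ₀ : MemP1 ρ₀) {t : ℝ} (ht : t ∈ Icc 0 T) : MemP1 (ρ t) := by
  unfold MemP1
  rw [hX.map_eq, lintegral_map measurable_enorm (hX.continuous t).measurable]
  calc ∫⁻ x, ‖X t x‖ₑ ∂(ρ₀ : Measure (Space d))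
      ≤ ∫⁻ x, (‖x‖ₑ + ENNReal.ofReal (M * t)) ∂(ρ₀ : Measure (Space d)) := by
        refine lintegral_mono fun x => ?_
        have h1 := hX.norm_sub_le h (s := 0) ⟨le_rfl, ht.1.trans ht.2⟩ ht x
        rw [hX.initial, sub_zero, abs_of_nonneg ht.1] at h1
        calc ‖X t x‖ₑ = ‖x + (X t x - x)‖ₑ := by rw [add_sub_cancel]
          _ ≤ ‖x‖ₑ + ‖X t x - x‖ₑ := enorm_add_le _ _
          _ ≤ _ := by
            rw [← ofReal_norm (X t x - x)]
            gcongr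
    _ < ⊤ := by
        rw [lintegral_add_right _ measurable_const]
        have : ∫⁻ x, ‖x‖ₑ ∂(ρ₀ : Measure (Space d)) < ⊤ := hρ₀
        simp [this]

lemma IsMeanFieldFlow.continuousInP1 (hX : IsMeanFieldFlow K T ρ₀ X ρ)
    (h : IsRegularKernel (∇ K) M L) (hρ₀ : MemP1 ρ₀) : ContinuousInP1 T ρ := by
  refine ⟨fun t ht => hX.memP1 h hρ₀ (Ico_subset_Icc_self ht), fun t ht => ?_⟩
  have hlim : Tendsto (fun s => ENNReal.ofReal (M * |s - t|)) (𝓝[Ico 0 T] t) (𝓝 0) := by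
    have : Continuous fun s => ENNReal.ofReal (M * |s - t|) := 
      ENNReal.continuous_ofReal.comp (by fun_prop)
    simpa using (this.tendsto t).mono_left nhdsWithin_le_nhds
  refine tendsto_of_tendsto_of_tendsto_of_le_of_le' tendsto_const_nhds hlim
    (.of_forall fun _ => zero_le) ?_
  filter_upwards [self_mem_nhdsWithin] with s hs
  exact W1_le_of_norm_sub_le (hX.continuous s).measurable.aemeasurable
    (hX.continuous t).measurable.aemeasurable (hX.map_eq s) (hX.map_eq t)
    (.of_forall fun x => hX.norm_sub_le h (Ico_subset_Icc_self ht) (Ico_subset_Icc_self hs) x)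

end FlowProperties

/-! ### Differential inequalities for the characteristics. -/

lemma hasDerivWithinAt_Ici_of_Ico {E : Type*} [NormedAddCommGroup E] [NormedSpace ℝ E]
    {g : ℝ → E} {g' : E} {t : ℝ} (ht : t ∈ Ico 0 T) (h : HasDerivWithinAt g g' (Ico 0 T) t) :
    HasDerivWithinAt g g' (Ici t) t :=
  (h.mono (Ico_subset_Ico_left ht.1)).mono_of_mem_nhdsWithin (Ico_mem_nhdsGE ht.2)

/-- A damped velocity stays bounded by its initial size plus the size of the force. -/
lemma norm_damped_le (hε : 0 < ε) (hM : 0 ≤ M) {v E : ℝ → Space d} (hE : ∀ t ∈ Ico 0 T, ‖E t‖ ≤ M)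
    (hv : ∀ t ∈ Ico 0 T, HasDerivWithinAt v (-(1 / ε) • v t - (1 / ε) • E t) (Ico 0 T) t)
    {t : ℝ} (ht : t ∈ Ico 0 T) : ‖v t‖ ≤ ‖v 0‖ + M := by
  have hexp : ∀ s, HasDerivAt (fun s => Real.exp (s / ε)) (Real.exp (s / ε) * (1 / ε)) s :=
    fun s => ((hasDerivAt_id s).div_const ε).exp
  -- The integrating factor exp(s/ε) removes the damping term. Integrating the force produces
  -- M(exp(s/ε) - 1), whose 1/ε has cancelled, so the final bound does not depend on ε.
  have key := image_norm_le_of_norm_deriv_right_le_deriv_boundary (a := 0) (b := t)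
    (f := fun s => Real.exp (s / ε) • v s)
    (f' := fun s => -(Real.exp (s / ε) * (1 / ε)) • E s)
    (B := fun s => ‖v 0‖ + M * (Real.exp (s / ε) - 1))
    (B' := fun s => M * (Real.exp (s / ε) * (1 / ε))) ?_ ?_ ?_ ?_ ?_ (x := t) ⟨ht.1, le_rfl⟩
  · rw [norm_smul, Real.norm_of_nonneg (Real.exp_pos _).le] at key
    have h1 : 1 ≤ Real.exp (t / ε) := Real.one_le_exp (div_nonneg ht.1 hε.le)
    have h2 : Real.exp (t / ε) * ‖v t‖ ≤ Real.exp (t / ε) * (‖v 0‖ + M) := by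
      nlinarith [norm_nonneg (v 0)]
    exact le_of_mul_le_mul_left h2 (Real.exp_pos _)
  · intro s hs
    have hs' : s ∈ Ico 0 T := ⟨hs.1, hs.2.trans_lt ht.2⟩
    exact ((hexp s).continuousAt.continuousWithinAt.smul
      ((hv s hs').continuousWithinAt.mono fun r hr => ⟨hr.1, hr.2.trans_lt ht.2⟩))
  · intro s hs
    have hs' : s ∈ Ico 0 T := ⟨hs.1, hs.2.trans ht.2⟩
    have := (hexp s).hasDerivWithinAt.smul (hasDerivWithinAt_Ici_of_Ico hs' (hv s hs'))
    refine this.congr_deriv ?_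
    module
  · simp
  · intro s
    exact (((hexp s).sub_const 1).const_mul M).const_add _
  · intro s hs
    rw [norm_smul, norm_neg, Real.norm_of_nonneg (by positivity), mul_comm]
    have := hE s ⟨hs.1, hs.2.trans ht.2⟩
    gcongr

/-- A curve whose speed grows at most exponentially. -/
lemma norm_sub_le_of_norm_deriv_le_exp {w w' : ℝ → Space d} {A l : ℝ} (hl : 0 < l) (hA : 0 ≤ A)
    (hw : ∀ t ∈ Ico 0 T, HasDerivWithinAt w (w' t) (Ico 0 T) t)
    (hw' : ∀ t ∈ Ico 0 T, ‖w' t‖ ≤ A * Real.exp (l * t)) {t : ℝ} (ht : t ∈ Ico 0 T) :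
    ‖w t - w 0‖ ≤ A / l * Real.exp (l * t) := by
  have key := image_norm_le_of_norm_deriv_right_le_deriv_boundary (a := 0) (b := t)
    (f := fun s => w s - w 0) (f' := w')
    (B := fun s => A / l * Real.exp (l * s))
    (B' := fun s => A * Real.exp (l * s)) ?_ ?_ ?_ ?_ ?_ (x := t) ⟨ht.1, le_rfl⟩
  · exact key
  · intro s hs
    exact ((hw s ⟨hs.1, hs.2.trans_lt ht.2⟩).continuousWithinAt.mono
      fun r hr => ⟨hr.1, hr.2.trans_lt ht.2⟩).sub continuousWithinAt_const
  · intro s hs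
    have hs' : s ∈ Ico 0 T := ⟨hs.1, hs.2.trans ht.2⟩
    exact (hasDerivWithinAt_Ici_of_Ico hs' (hw s hs')).sub_const _
  · simp; positivity
  · intro s
    have h1 : HasDerivAt (fun s => Real.exp (l * s)) (Real.exp (l * s) * (l * 1)) s :=
      ((hasDerivAt_id s).const_mul l).exp
    exact (h1.const_mul (A / l)).congr_deriv (by field_simp)
  · intro s hs
    exact hw' s ⟨hs.1, hs.2.trans ht.2⟩

/-! ### The limit ε → 0 along characteristics. -/

section Convergence

variable {f₀ : ProbabilityMeasure (Space d × Space d)}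
  {f : ℝ → ProbabilityMeasure (Space d × Space d)}
  {Φ : ℝ → Space d × Space d → Space d × Space d}
  {X : ℝ → Space d → Space d} {ρ : ℝ → ProbabilityMeasure (Space d)}

lemma toMeasure_marginal (μ : ProbabilityMeasure (Space d × Space d)) :
    (marginal μ : Measure (Space d)) = (μ : Measure (Space d × Space d)).map Prod.fst :=
  ProbabilityMeasure.toMeasure_map _ _

lemma norm_velocity_le (h : IsRegularKernel (∇ K) M L) (hε : 0 < ε)
    (hΦ : IsCharacteristicFlow ε T (fun t => gradConv K (marginal (f t))) Φ)
    (z : Space d × Space d) {t : ℝ} (ht : t ∈ Ico 0 T) : ‖(Φ t z).2‖ ≤ ‖z.2‖ + M := by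
  have := norm_damped_le (T := T) hε h.bound_nonneg (v := fun t => (Φ t z).2)
    (E := fun t => gradConv K (marginal (f t)) (Φ t z).1) (fun t _ => norm_gradConv_le h _ _)
    (fun s hs => (hasFDerivAt_snd.comp_hasDerivWithinAt s ((hΦ z).2 s hs) :)) ht
  rwa [(hΦ z).1] at this

/-- The deviation of the slow variable `x + ε v` from the limit characteristic moves with the
difference of the two force fields. -/
lemma hasDerivWithinAt_slow_sub (hε : 0 < ε)
    (hΦ : IsCharacteristicFlow ε T (fun t => gradConv K (marginal (f t))) Φ)
    (hX : IsMeanFieldFlow K T (marginal f₀) X ρ) (z : Space d × Space d) {t : ℝ}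
    (ht : t ∈ Ico 0 T) :
    HasDerivWithinAt (fun s => (Φ s z).1 + ε • (Φ s z).2 - X s z.1)
      (gradConv K (ρ t) (X t z.1) - gradConv K (marginal (f t)) (Φ t z).1) (Ico 0 T) t := by
  have h1 := (hasFDerivAt_fst (𝕜 := ℝ)).comp_hasDerivWithinAt t ((hΦ z).2 t ht)
  have h2 := (hasFDerivAt_snd (𝕜 := ℝ)).comp_hasDerivWithinAt t ((hΦ z).2 t ht)
  have h3 := (hX.hasDerivAt t (Ico_subset_Icc_self ht) z.1).hasDerivWithinAt (s := Ico 0 T)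
  -- The term v from the position cancels ε · (-v/ε) from the velocity; only the two forces survive.
  refine ((h1.add (h2.const_smul ε)).sub h3).congr_deriv ?_
  simp only [ContinuousLinearMap.coe_fst', ContinuousLinearMap.coe_snd', smul_sub, smul_smul,
    one_div, smul_neg, mul_inv_cancel₀ hε.ne', one_smul, neg_smul, smul_sub]
  abel

/-- A position that is within `D` of the limit characteristic, in terms of the slow deviation. -/
lemma norm_sub_flow_le (h : IsRegularKernel (∇ K) M L) (hε : 0 < ε)
    (hΦ : IsCharacteristicFlow ε T (fun t => gradConv K (marginal (f t))) Φ)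
    (hX : IsMeanFieldFlow K T (marginal f₀) X ρ) (z : Space d × Space d) {B l : ℝ} (hl : 0 < l)
    (hB : 0 ≤ B)
    (hw : ∀ t ∈ Ico 0 T, ‖gradConv K (ρ t) (X t z.1) - gradConv K (marginal (f t)) (Φ t z).1‖
      ≤ B * Real.exp (l * t)) {t : ℝ} (ht : t ∈ Ico 0 T) :
    ‖(Φ t z).1 - X t z.1‖ ≤ ε * (2 * ‖z.2‖ + M) + B / l * Real.exp (l * t) := by
  have h1 := norm_sub_le_of_norm_deriv_le_exp hl hB
    (fun t ht => hasDerivWithinAt_slow_sub hε hΦ hX z ht) hw ht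
  have h2 := norm_velocity_le h hε hΦ z ht
  -- The slow deviation starts at ε v₀ rather than 0, which accounts for the ε v₀ in the last
  -- bracket.
  have h3 : (Φ t z).1 - X t z.1 = ((Φ t z).1 + ε • (Φ t z).2 - X t z.1
      - ((Φ 0 z).1 + ε • (Φ 0 z).2 - X 0 z.1)) + (ε • z.2 - ε • (Φ t z).2) := by
    rw [(hΦ z).1, hX.initial]; abel
  have h4 : ‖ε • z.2 - ε • (Φ t z).2‖ ≤ ε * (2 * ‖z.2‖ + M) := by
    rw [← smul_sub, norm_smul, Real.norm_of_nonneg hε.le]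
    gcongr
    linarith [norm_sub_le z.2 (Φ t z).2]
  rw [h3]
  linarith [norm_add_le ((Φ t z).1 + ε • (Φ t z).2 - X t z.1
      - ((Φ 0 z).1 + ε • (Φ 0 z).2 - X 0 z.1)) (ε • z.2 - ε • (Φ t z).2)]

/-- Along the characteristics that start from a set of full measure with velocities bounded by `R`,
the distance to the limit flow is of order `ε`. -/
lemma norm_sub_flow_le_mul_exp (h : IsRegularKernel (∇ K) M L) (hε : 0 < ε)
    (hΦ : IsCharacteristicFlow ε T (fun t => gradConv K (marginal (f t))) Φ)
    (hf : ∀ t ∈ Ico 0 T, AEMeasurable (Φ t) (f₀ : Measure (Space d × Space d)) ∧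
      (f t : Measure (Space d × Space d)) = (f₀ : Measure (Space d × Space d)).map (Φ t))
    (hX : IsMeanFieldFlow K T (marginal f₀) X ρ) {S : Set (Space d × Space d)}
    (hS : ∀ᵐ z ∂(f₀ : Measure (Space d × Space d)), z ∈ S) {R : ℝ} (hR : ∀ z ∈ S, ‖z.2‖ ≤ R)
    {z : Space d × Space d} (hz : z ∈ S) {t : ℝ} (ht : t ∈ Ico 0 T) :
    ‖(Φ t z).1 - X t z.1‖ ≤ 2 * (ε * (2 * R + M)) * Real.exp (4 * L * t) := by
  have hL := h.lipschitz_pos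
  have hM := h.bound_nonneg
  have hR0 : 0 ≤ R := (norm_nonneg _).trans (hR z hz)
  set c := ε * (2 * R + M) with hc
  have hc0 : 0 ≤ c := by positivity
  have hexp : ∀ s ∈ Ico 0 T, 1 ≤ Real.exp (4 * L * s) := fun s hs =>
    Real.one_le_exp (by have := hs.1; positivity)
  -- Gronwall as a contraction in the norm weighted by exp(-4Lt). Point and measure each deviate by
  -- A exp(4Lr), so the forces differ by at most 2LA exp(4Lr); integration divides by 4L and returns
  -- A/2. Working with admissible constants A avoids any regularity in time of the supremum over S.
  have improve : ∀ A, 0 ≤ A →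
      (∀ z ∈ S, ∀ s ∈ Ico 0 T, ‖(Φ s z).1 - X s z.1‖ ≤ A * Real.exp (4 * L * s)) →
      ∀ z ∈ S, ∀ s ∈ Ico 0 T,
        ‖(Φ s z).1 - X s z.1‖ ≤ (c + A / 2) * Real.exp (4 * L * s) := by
    intro A hA hD z hz s hs
    have := norm_sub_flow_le h hε hΦ hX z (B := L * (2 * A)) (l := 4 * L) (by positivity)
      (by positivity) (fun r hr => ?_) hs
    · have h1 : ε * (2 * ‖z.2‖ + M) ≤ c * Real.exp (4 * L * s) := by
        have : ε * (2 * ‖z.2‖ + M) ≤ c := by rw [hc]; gcongr; exact hR z hz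
        nlinarith [hexp s hs]
      have h2 : L * (2 * A) / (4 * L) = A / 2 := by field_simp; ring
      rw [h2] at this
      linarith
    · have hb := norm_gradConv_sub_gradConv_le h (P := (f₀ : Measure (Space d × Space d)))
        (g := fun z => X r z.1) (g' := fun z => (Φ r z).1)
        ((hX.continuous r).measurable.comp measurable_fst).aemeasurable (hf r hr).1.fst
        (μ := ρ r) (μ' := marginal (f r)) ?_ ?_ (D := A * Real.exp (4 * L * r)) ?_
        (X r z.1) (Φ r z).1
      · refine hb.trans ?_
        have := hD z hz r hr
        rw [norm_sub_rev] at this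
        nlinarith
      · rw [hX.map_eq, toMeasure_marginal, Measure.map_map (hX.continuous r).measurable
          measurable_fst]; rfl
      · rw [toMeasure_marginal, (hf r hr).2,
          AEMeasurable.map_map_of_aemeasurable measurable_fst.aemeasurable (hf r hr).1]; rfl
      · filter_upwards [hS] with y hy
        rw [norm_sub_rev]
        exact hD y hy r hr
  set s := {A : ℝ | 0 ≤ A ∧
    ∀ z ∈ S, ∀ s ∈ Ico 0 T, ‖(Φ s z).1 - X s z.1‖ ≤ A * Real.exp (4 * L * s)}
  have hbdd : BddBelow s := ⟨0, fun A hA => hA.1⟩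
  have hne : s.Nonempty := by
    -- A first finite constant comes from the crude bound 2M on the force difference.
    refine ⟨c + 2 * M / (4 * L), by positivity, fun z hz s hs => ?_⟩
    have := norm_sub_flow_le h hε hΦ hX z (B := 2 * M) (l := 4 * L) (by positivity)
      (by positivity) (fun r hr => ?_) hs
    · have h1 : ε * (2 * ‖z.2‖ + M) ≤ c * Real.exp (4 * L * s) := by
        have : ε * (2 * ‖z.2‖ + M) ≤ c := by rw [hc]; gcongr; exact hR z hz
        nlinarith [hexp s hs]
      linarith
    · have h1 : ‖gradConv K (ρ r) (X r z.1) - gradConv K (marginal (f r)) (Φ r z).1‖ ≤ 2 * M := by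
        linarith [norm_sub_le (gradConv K (ρ r) (X r z.1))
          (gradConv K (marginal (f r)) (Φ r z).1), norm_gradConv_le h (ρ r) (X r z.1),
          norm_gradConv_le h (marginal (f r)) (Φ r z).1]
      nlinarith [hexp r hr]
  have hinf : sInf s ∈ s := by
    refine ⟨Real.sInf_nonneg fun A hA => hA.1, fun z hz r hr => ?_⟩
    rw [← div_le_iff₀ (Real.exp_pos _)]
    exact le_csInf hne fun A hA => (div_le_iff₀ (Real.exp_pos _)).2 (hA.2 z hz r hr)
  -- The best constant is itself admissible, so improving it cannot lower it; hence it is at most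
  -- 2c.
  have hle : sInf s ≤ c + sInf s / 2 :=
    csInf_le hbdd ⟨by linarith [hinf.1], improve _ hinf.1 hinf.2⟩
  refine (hinf.2 z hz t ht).trans ?_
  gcongr
  linarith

/-- Compact support bounds the initial velocities by one R, so the deviation bound is uniform for
f₀-almost every starting point and transfers to `W1` through the coupling by that point. -/
lemma tendsto_W1_marginal (h : IsRegularKernel (∇ K) M L)
    (hsupp : IsCompact (f₀ : Measure (Space d × Space d)).support)
    {f : ℝ → ℝ → ProbabilityMeasure (Space d × Space d)}
    (hf : ∀ ε : ℝ, 0 < ε → IsMeasureSolution K ε T f₀ (f ε))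
    (hX : IsMeanFieldFlow K T (marginal f₀) X ρ) {t : ℝ} (ht : t ∈ Ico 0 T) :
    Tendsto (fun ε => W1 (marginal (f ε t)) (ρ t)) (𝓝[>] 0) (𝓝 0) := by
  obtain ⟨R, hR⟩ := hsupp.isBounded.exists_norm_le
  have hS : ∀ᵐ z ∂(f₀ : Measure (Space d × Space d)),
      z ∈ (f₀ : Measure (Space d × Space d)).support := Measure.support_mem_ae
  have hlim : Tendsto (fun ε => ENNReal.ofReal (2 * (ε * (2 * R + M)) * Real.exp (4 * L * t)))
      (𝓝[>] 0) (𝓝 0) := by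
    have : Continuous fun ε => ENNReal.ofReal (2 * (ε * (2 * R + M)) * Real.exp (4 * L * t)) :=
      ENNReal.continuous_ofReal.comp (by fun_prop)
    simpa using (this.tendsto 0).mono_left nhdsWithin_le_nhds
  refine tendsto_of_tendsto_of_tendsto_of_le_of_le' tendsto_const_nhds hlim
    (.of_forall fun _ => zero_le) ?_
  filter_upwards [self_mem_nhdsWithin] with ε hε
  obtain ⟨Φ, hΦ, hfΦ⟩ := (hf ε hε).transport
  refine W1_le_of_norm_sub_le (P := (f₀ : Measure (Space d × Space d)))
    (g := fun z => (Φ t z).1) (g' := fun z => X t z.1) (hfΦ t ht).1.fst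
    ((hX.continuous t).measurable.comp measurable_fst).aemeasurable ?_ ?_ ?_
  · rw [toMeasure_marginal, (hfΦ t ht).2,
      AEMeasurable.map_map_of_aemeasurable measurable_fst.aemeasurable (hfΦ t ht).1]; rfl
  · rw [hX.map_eq, toMeasure_marginal, Measure.map_map (hX.continuous t).measurable
      measurable_fst]; rfl
  · filter_upwards [hS] with z hz
    exact norm_sub_flow_le_mul_exp h hε hΦ hfΦ hX hS
      (fun z hz => (norm_snd_le z).trans (hR z hz)) hz ht

end Convergence

/-! ### Narrow continuity of linear and quadratic functionals of a measure. -/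

section Pairing

/-- The pairing of bounded continuous functions with probability measures is jointly continuous. -/
lemma tendsto_integral_pairing {ι X : Type*} [TopologicalSpace X] [MeasurableSpace X]
    [OpensMeasurableSpace X] {l : Filter ι} {u : ι → X →ᵇ ℝ} {u₀ : X →ᵇ ℝ}
    {μ : ι → ProbabilityMeasure X} {μ₀ : ProbabilityMeasure X} (hu : Tendsto u l (𝓝 u₀))
    (hμ : Tendsto μ l (𝓝 μ₀)) :
    Tendsto (fun i => ∫ x, u i x ∂(μ i : Measure X)) l (𝓝 (∫ x, u₀ x ∂(μ₀ : Measure X))) := by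
  have h1 : ∀ i, ∫ x, u i x ∂(μ i : Measure X)
      = ∫ x, (u i - u₀) x ∂(μ i : Measure X) + ∫ x, u₀ x ∂(μ i : Measure X) := fun i => by
    rw [← integral_add ((u i - u₀).integrable _) (u₀.integrable _)]
    simp
  simp_rw [h1]
  have h2 : Tendsto (fun i => ∫ x, (u i - u₀) x ∂(μ i : Measure X)) l (𝓝 0) := by
    refine squeeze_zero_norm (fun i => ?_) (tendsto_iff_norm_sub_tendsto_zero.1 hu)
    simpa using (u i - u₀).norm_integral_le_norm (μ i : Measure X)
  simpa using h2.add (ProbabilityMeasure.tendsto_iff_forall_integral_tendsto.1 hμ u₀)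

/-- The function `(x, y) ↦ ⟨g x, ∇K (x - y)⟩`. -/
def innerKernel (h : IsRegularKernel (∇ K) M L) (g : Space d →ᵇ Space d) :
    Space d × Space d →ᵇ ℝ :=
  BoundedContinuousFunction.ofNormedAddCommGroup
    (fun p => inner ℝ (g p.1) (∇ K (p.1 - p.2)))
    (Continuous.inner (by fun_prop) (h.continuous.comp (by fun_prop))) (‖g‖ * M)
    (fun p => (norm_inner_le_norm _ _).trans
      (mul_le_mul (g.norm_coe_le_norm _) (h.norm_le _) (norm_nonneg _) (norm_nonneg _)))

lemma continuous_innerKernel (h : IsRegularKernel (∇ K) M L) : Continuous (innerKernel h) := by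
  have hM := h.bound_nonneg
  refine (LipschitzWith.of_dist_le_mul (K := M.toNNReal) fun g g' => ?_).continuous
  rw [dist_eq_norm, dist_eq_norm, Real.coe_toNNReal _ hM, mul_comm]
  refine (BoundedContinuousFunction.norm_le (by positivity)).2 fun p => ?_
  change ‖inner ℝ (g p.1) (∇ K (p.1 - p.2)) - inner ℝ (g' p.1) (∇ K (p.1 - p.2))‖ ≤ _
  rw [← inner_sub_left]
  exact (norm_inner_le_norm _ _).trans
      (mul_le_mul ((g - g').norm_coe_le_norm _) (h.norm_le _) (norm_nonneg _) (norm_nonneg _))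

/-- The flux is quadratic in μ. As a linear functional of μ ⊗ μ with a bounded continuous integrand,
it inherits narrow continuity from that of the product. -/
lemma integral_innerKernel (h : IsRegularKernel (∇ K) M L) (g : Space d →ᵇ Space d)
    (μ : ProbabilityMeasure (Space d)) :
    ∫ p, innerKernel h g p ∂((μ.prod μ : ProbabilityMeasure _) : Measure (Space d × Space d))
      = ∫ x, inner ℝ (g x) (gradConv K μ x) ∂(μ : Measure (Space d)) := by
  rw [ProbabilityMeasure.toMeasure_prod,
    integral_prod _ (by
      rw [← ProbabilityMeasure.toMeasure_prod]; exact (innerKernel h g).integrable _)]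
  refine integral_congr_ae (.of_forall fun x => ?_)
  exact integral_inner (h.integrable (g := fun y => x - y) (by fun_prop)) (g x)

lemma continuousOn_integral_pairing {u : ℝ → Space d →ᵇ ℝ} {σ : ℝ → ProbabilityMeasure (Space d)}
    {S : Set ℝ} (hu : ContinuousOn u S) (hσ : ContinuousOn σ S) :
    ContinuousOn (fun t => ∫ x, u t x ∂(σ t : Measure (Space d))) S :=
  fun t ht => tendsto_integral_pairing (hu t ht) (hσ t ht)

lemma continuousOn_integral_inner_gradConv (h : IsRegularKernel (∇ K) M L)
    {g : ℝ → Space d →ᵇ Space d} {σ : ℝ → ProbabilityMeasure (Space d)}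
    {S : Set ℝ} (hg : ContinuousOn g S) (hσ : ContinuousOn σ S) :
    ContinuousOn (fun t => ∫ x, inner ℝ (g t x) (gradConv K (σ t) x) ∂(σ t : Measure (Space d)))
      S := by
  simp_rw [← integral_innerKernel h]
  exact fun t ht => tendsto_integral_pairing (((continuous_innerKernel h).tendsto _).comp (hg t ht))
    ((ProbabilityMeasure.continuous_prod.tendsto (σ t, σ t)).comp
      ((hσ t ht).prodMk_nhds (hσ t ht)))

end Pairing

/-! ### The limit curve solves the weak equation. -/

section WeakForm

/-- Nothing is known at the endpoint T, which is a null set. -/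
lemma intervalIntegral_eq_of_eq_zero {b : ℝ} (hb : 0 ≤ b) (hbT : b ≤ T) {g : ℝ → ℝ}
    (hg : ∀ t ∈ Ioo b T, g t = 0) : ∫ t in (0 : ℝ)..T, g t = ∫ t in (0 : ℝ)..b, g t := by
  rw [intervalIntegral.integral_of_le hb, intervalIntegral.integral_of_le (hb.trans hbT)]
  refine setIntegral_eq_of_subset_of_ae_sdiff_eq_zero measurableSet_Ioc.nullMeasurableSet
    (Ioc_subset_Ioc_right hbT) ?_
  have : ∀ᵐ t : ℝ, t ≠ T := by simp [ae_iff]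
  filter_upwards [this] with t ht h
  exact hg t ⟨by by_contra hlt; exact h.2 ⟨h.1.1, not_lt.1 hlt⟩, lt_of_le_of_ne h.1.2 ht⟩

namespace TestFun

variable (ψ : TestFun d T)

lemma hasDerivAt_val {t : ℝ} (ht : t ∈ Ioo 0 T) : HasDerivAt ψ.val (ψ.timeDeriv t) t :=
  ((ψ.contDiffOn_val.differentiableOn one_ne_zero t
    ⟨ht.1.le, ht.2⟩).hasDerivWithinAt).hasDerivAt (Ico_mem_nhds ht.1 ht.2)

lemma continuousOn_timeDeriv : ContinuousOn ψ.timeDeriv (Ico 0 T) :=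
  ψ.contDiffOn_val.continuousOn_derivWithin (uniqueDiffOn_Ico 0 T) le_rfl

lemma timeDeriv_eq_zero {b t : ℝ} (hb : ∀ s ∈ Ico 0 T, b < s → ψ.val s = 0) (hb0 : 0 ≤ b)
    (ht : t ∈ Ioo b T) : ψ.timeDeriv t = 0 := by
  have h1 : ψ.val =ᶠ[𝓝 t] fun _ => 0 := by
    filter_upwards [Ioo_mem_nhds ht.1 ht.2] with s hs
    exact hb s ⟨hb0.trans hs.1.le, hs.2⟩ hs.1
  exact (ψ.hasDerivAt_val ⟨hb0.trans_lt ht.1, ht.2⟩).unique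
    ((hasDerivAt_const t 0).congr_of_eventuallyEq h1)

lemma grad_eq_zero {b t : ℝ} (hb : ∀ s ∈ Ico 0 T, b < s → ψ.val s = 0) (hb0 : 0 ≤ b)
    (ht : t ∈ Ioo b T) : ψ.grad t = 0 := by
  have ht' : t ∈ Ico 0 T := ⟨hb0.trans ht.1.le, ht.2⟩
  ext1 x
  have h1 := ψ.hasGradientAt t ht' x
  rw [hb t ht' ht.1] at h1
  exact h1.unique (hasGradientAt_const x 0)

end TestFun

/-- Chain rule for the evaluation of a curve of bounded continuous functions along a curve. -/
lemma hasDerivAt_eval {u : ℝ → Space d →ᵇ ℝ} {u' : Space d →ᵇ ℝ} {γ : ℝ → Space d}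
    {γ' g : Space d} {t : ℝ} (hu : HasDerivAt u u' t) (hg : HasGradientAt (u t) g (γ t))
    (hγ : HasDerivAt γ γ' t) :
    HasDerivAt (fun s => u s (γ s)) (u' (γ t) + inner ℝ g γ') t := by
  have h1 : HasDerivAt (fun s => u t (γ s)) (inner ℝ g γ') t := by
    exact hg.hasFDerivAt.comp_hasDerivAt t hγ
  -- The slopes of u converge uniformly in space, so evaluating them at the moving point γ(s) is
  -- harmless.
  have h2 : HasDerivAt (fun s => (u s - u t) (γ s)) (u' (γ t)) t := by
    rw [hasDerivAt_iff_tendsto_slope] at hu ⊢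
    have h3 : Tendsto (fun s => slope u t s (γ s)) (𝓝[≠] t) (𝓝 (u' (γ t))) := by
      rw [tendsto_iff_norm_sub_tendsto_zero] at hu ⊢
      have h4 : Tendsto (fun s => ‖u' (γ s) - u' (γ t)‖) (𝓝[≠] t) (𝓝 0) :=
        tendsto_iff_norm_sub_tendsto_zero.1
          ((u'.continuous.continuousAt.comp hγ.continuousAt).tendsto.mono_left nhdsWithin_le_nhds)
      refine squeeze_zero (fun _ => norm_nonneg _) (fun s => ?_) (by simpa using hu.add h4)
      calc ‖slope u t s (γ s) - u' (γ t)‖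
          = ‖(slope u t s - u') (γ s) + (u' (γ s) - u' (γ t))‖ := by simp
        _ ≤ _ := (norm_add_le _ _).trans
            (add_le_add ((slope u t s - u').norm_coe_le_norm _) (Real.norm_eq_abs _).le)
    refine h3.congr fun s => ?_
    simp [slope_def_module]
  refine (h2.add h1).congr_of_eventuallyEq (.of_forall fun s => ?_)
  simp

variable {ρ₀ : ProbabilityMeasure (Space d)} {X : ℝ → Space d → Space d}
  {ρ : ℝ → ProbabilityMeasure (Space d)}

lemma IsMeanFieldFlow.integral_eq (hX : IsMeanFieldFlow K T ρ₀ X ρ) {g : Space d → ℝ}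
    (hg : Continuous g) (t : ℝ) :
    ∫ x, g x ∂(ρ t : Measure (Space d)) = ∫ x, g (X t x) ∂(ρ₀ : Measure (Space d)) := by
  rw [hX.map_eq, integral_map (hX.continuous t).measurable.aemeasurable hg.aestronglyMeasurable]

lemma IsMeanFieldFlow.continuousOn (hX : IsMeanFieldFlow K T ρ₀ X ρ) :
    ContinuousOn ρ (Icc 0 T) := by
  intro t ht
  refine ProbabilityMeasure.tendsto_iff_forall_integral_tendsto.2 fun g => ?_
  simp_rw [hX.integral_eq g.continuous]
  refine tendsto_integral_filter_of_dominated_convergence (fun _ => ‖g‖)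
    (.of_forall fun s => (g.continuous.comp (hX.continuous s)).aestronglyMeasurable)
    (.of_forall fun s => .of_forall fun x => g.norm_coe_le_norm _) (integrable_const _)
    (.of_forall fun x => ?_)
  exact (g.continuous.continuousAt.comp
    (hX.hasDerivAt t ht x).continuousAt).tendsto.mono_left nhdsWithin_le_nhds

lemma IsMeanFieldFlow.map_zero (hX : IsMeanFieldFlow K T ρ₀ X ρ) : ρ 0 = ρ₀ := by
  apply Subtype.ext
  have : X 0 = id := funext hX.initial
  exact (hX.map_eq 0).trans (by rw [this]; exact Measure.map_id)

/-- Pulling back by the flow fixes the measure ρ₀, after which differentiation under the integral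
applies; compactness of [0, b] supplies the dominating constant. -/
lemma IsMeanFieldFlow.hasDerivAt_integral (hX : IsMeanFieldFlow K T ρ₀ X ρ)
    (h : IsRegularKernel (∇ K) M L) (ψ : TestFun d T) {b : ℝ} (hbT : b < T) {t : ℝ}
    (ht : t ∈ Ioo 0 b) :
    HasDerivAt (fun s => ∫ x, ψ.val s x ∂(ρ s : Measure (Space d)))
      (∫ x, ψ.timeDeriv t x ∂(ρ t : Measure (Space d))
        - ∫ x, inner ℝ (ψ.grad t x) (gradConv K (ρ t) x) ∂(ρ t : Measure (Space d))) t := by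
  have hsub : Icc 0 b ⊆ Ico 0 T := fun s hs => ⟨hs.1, hs.2.trans_lt hbT⟩
  obtain ⟨C₁, hC₁⟩ := isCompact_Icc.exists_bound_of_continuousOn
    (ψ.continuousOn_timeDeriv.mono hsub)
  obtain ⟨C₂, hC₂⟩ := isCompact_Icc.exists_bound_of_continuousOn
    (ψ.contDiffOn_grad.continuousOn.mono hsub)
  have hcont : ∀ s, Continuous fun x => inner ℝ (ψ.grad s x) (gradConv K (ρ s) x) := fun s =>
    (ψ.grad s).continuous.inner (continuous_gradConv h _)
  have hp : ∀ s ∈ Ioo 0 b, ∀ x, HasDerivAt (fun r => ψ.val r (X r x))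
      (ψ.timeDeriv s (X s x) - inner ℝ (ψ.grad s (X s x)) (gradConv K (ρ s) (X s x))) s := by
    intro s hs x
    have hs' : s ∈ Icc 0 T := ⟨hs.1.le, (hs.2.trans hbT).le⟩
    have := hasDerivAt_eval (ψ.hasDerivAt_val ⟨hs.1, hs.2.trans hbT⟩)
      (ψ.hasGradientAt s ⟨hs.1.le, hs.2.trans hbT⟩ (X s x)) (hX.hasDerivAt s hs' x)
    rwa [inner_neg_right, ← sub_eq_add_neg] at this
  have key := hasDerivAt_integral_of_dominated_loc_of_deriv_le (μ := (ρ₀ : Measure (Space d)))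
    (F := fun r x => ψ.val r (X r x)) (x₀ := t) (bound := fun _ => C₁ + C₂ * M)
    (F' := fun s x => ψ.timeDeriv s (X s x)
      - inner ℝ (ψ.grad s (X s x)) (gradConv K (ρ s) (X s x)))
    (Ioo_mem_nhds ht.1 ht.2)
    (.of_forall fun s => ((ψ.val s).continuous.comp (hX.continuous s)).aestronglyMeasurable)
    (Integrable.of_bound ((ψ.val t).continuous.comp (hX.continuous t)).aestronglyMeasurable
      ‖ψ.val t‖ (.of_forall fun x => (ψ.val t).norm_coe_le_norm _))
    (((ψ.timeDeriv t).continuous.comp (hX.continuous t)).sub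
      ((hcont t).comp (hX.continuous t))).aestronglyMeasurable
    (.of_forall fun x s hs => ?_) (integrable_const _) (.of_forall fun x s hs => hp s hs x)
  · have hd := key.2
    rw [integral_sub] at hd
    · simp_rw [hX.integral_eq (ψ.val _).continuous, hX.integral_eq (ψ.timeDeriv t).continuous,
        hX.integral_eq (hcont t)]
      exact hd
    · exact Integrable.of_bound
        ((ψ.timeDeriv t).continuous.comp (hX.continuous t)).aestronglyMeasurable
        ‖ψ.timeDeriv t‖ (.of_forall fun x => (ψ.timeDeriv t).norm_coe_le_norm _)
    · refine Integrable.of_bound ((hcont t).comp (hX.continuous t)).aestronglyMeasurable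
        (‖ψ.grad t‖ * M) (.of_forall fun x => (norm_inner_le_norm _ _).trans ?_)
      exact mul_le_mul ((ψ.grad t).norm_coe_le_norm _) (norm_gradConv_le h _ _) (norm_nonneg _)
        (norm_nonneg _)
  · have hs' := Ioo_subset_Icc_self hs
    refine (_root_.norm_sub_le _ _).trans (add_le_add
      (((ψ.timeDeriv s).norm_coe_le_norm _).trans (hC₁ s hs')) ((norm_inner_le_norm _ _).trans ?_))
    exact mul_le_mul (((ψ.grad s).norm_coe_le_norm _).trans (hC₂ s hs')) (norm_gradConv_le h _ _)
      (norm_nonneg _) ((norm_nonneg _).trans (hC₂ s hs'))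

lemma IsMeanFieldFlow.isWeakSolution (hX : IsMeanFieldFlow K T ρ₀ X ρ)
    (h : IsRegularKernel (∇ K) M L) (hT : 0 < T) : IsWeakSolution K T ρ₀ ρ := by
  have hρ : ContinuousOn ρ (Ico 0 T) := hX.continuousOn.mono Ico_subset_Icc_self
  refine ⟨hρ, fun ψ => ?_⟩
  obtain ⟨τ, hτT, hτ⟩ := ψ.compact_support
  -- The test function vanishes after b. Cutting the integrals at a later c < T keeps all integrands
  -- continuous on [0, c] and makes the boundary term at c zero.
  obtain ⟨b, hb, hbT⟩ := exists_between (max_lt hτT hT)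
  obtain ⟨c, hbc, hcT⟩ := exists_between hbT
  have hb0 : 0 < b := (le_max_right _ _).trans_lt hb
  have hzero : ∀ s ∈ Ico 0 T, b < s → ψ.val s = 0 := fun s hs hbs =>
    hτ s hs (((le_max_left _ _).trans_lt hb).trans hbs)
  have hc0 : 0 < c := hb0.trans hbc
  have hsub : Icc 0 c ⊆ Ico 0 T := fun s hs => ⟨hs.1, hs.2.trans_lt hcT⟩
  rw [intervalIntegral_eq_of_eq_zero hc0.le hcT.le fun t ht => by
      simp [ψ.timeDeriv_eq_zero hzero hb0.le ⟨hbc.trans ht.1, ht.2⟩],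
    intervalIntegral_eq_of_eq_zero hc0.le hcT.le fun t ht => by
      simp [ψ.grad_eq_zero hzero hb0.le ⟨hbc.trans ht.1, ht.2⟩]]
  have hi₁ : IntervalIntegrable (fun t => ∫ x, ψ.timeDeriv t x ∂(ρ t : Measure (Space d)))
      volume 0 c := by
    apply ContinuousOn.intervalIntegrable
    rw [uIcc_of_le hc0.le]
    exact (continuousOn_integral_pairing ψ.continuousOn_timeDeriv hρ).mono hsub
  have hi₂ : IntervalIntegrable (fun t => ∫ x, inner ℝ (ψ.grad t x) (gradConv K (ρ t) x)
      ∂(ρ t : Measure (Space d))) volume 0 c := by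
    apply ContinuousOn.intervalIntegrable
    rw [uIcc_of_le hc0.le]
    exact (continuousOn_integral_inner_gradConv h ψ.contDiffOn_grad.continuousOn hρ).mono hsub
  rw [← intervalIntegral.integral_sub hi₁ hi₂,
    intervalIntegral.integral_eq_sub_of_hasDerivAt_of_le hc0.le
      ((continuousOn_integral_pairing ψ.contDiffOn_val.continuousOn hρ).mono hsub)
      (fun t ht => hX.hasDerivAt_integral h ψ hcT ht) (hi₁.sub hi₂),
    hzero c ⟨hc0.le, hcT⟩ hbc, hX.map_zero]
  simp

end WeakForm

/-! ### From distributional to integrated equations in time. -/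

section DuBoisReymond

lemma eq_zero_of_integral_mul_sq_eq_zero {τ : ℝ} {G : ℝ → ℝ} (hG : Continuous G)
    (h0 : ∫ s in (0 : ℝ)..τ, (τ - s) * G s ^ 2 = 0) {t : ℝ} (ht : t ∈ Ico 0 τ) : G t = 0 := by
  by_contra hne
  have : 0 < ∫ s in (0 : ℝ)..τ, (τ - s) * G s ^ 2 := by
    refine intervalIntegral.integral_pos (ht.1.trans_lt ht.2) (by fun_prop) (fun s hs => ?_)
      ⟨t, Ico_subset_Icc_self ht, ?_⟩
    · have := sub_nonneg.2 hs.2; positivity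
    · have := sub_pos.2 ht.2; positivity
  exact this.ne' h0

/-- A function whose distributional derivative on `[0,T)`, with initial value `g₀`, is `-k`. -/
lemma eq_sub_integral_of_weak {g k : ℝ → ℝ} {g₀ : ℝ} (hg : ContinuousOn g (Ico 0 T))
    (hk : ContinuousOn k (Ico 0 T))
    (hw : ∀ χ χ' : ℝ → ℝ, (∀ t, HasDerivAt χ (χ' t) t) → Continuous χ' → ∀ τ ∈ Ioo 0 T,
      (∀ t, τ ≤ t → χ t = 0) → (∀ t, τ ≤ t → χ' t = 0) →
      (∫ t in (0 : ℝ)..τ, χ' t * g t) - (∫ t in (0 : ℝ)..τ, χ t * k t) + χ 0 * g₀ = 0)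
    {t : ℝ} (ht : t ∈ Ico 0 T) : g t = g₀ - ∫ s in (0 : ℝ)..t, k s := by
  obtain ⟨τ, htτ, hτT⟩ := exists_between ht.2
  have hτ : 0 < τ := ht.1.trans_lt htτ
  have hsub : Icc 0 τ ⊆ Ico 0 T := fun s hs => ⟨hs.1, hs.2.trans_lt hτT⟩
  -- Constant extension beyond [0, τ] gives globally continuous functions, so that the primitives
  -- below are differentiable everywhere.
  set g' : ℝ → ℝ := IccExtend hτ.le ((Icc 0 τ).domRestrict g)
  set k' : ℝ → ℝ := IccExtend hτ.le ((Icc 0 τ).domRestrict k)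
  have hgc : Continuous g' := (continuousOn_iff_continuous_domRestrict.1 (hg.mono hsub)).Icc_extend'
  have hkc : Continuous k' := (continuousOn_iff_continuous_domRestrict.1 (hk.mono hsub)).Icc_extend'
  have hgg : ∀ s ∈ Icc 0 τ, g' s = g s := fun s hs => IccExtend_of_mem _ _ hs
  have hkk : ∀ s ∈ Icc 0 τ, k' s = k s := fun s hs => IccExtend_of_mem _ _ hs
  set P : ℝ → ℝ := fun t => ∫ s in (0 : ℝ)..t, k' s with hP
  have hPd : ∀ t, HasDerivAt P (k' t) t := fun t => hkc.integral_hasStrictDerivAt 0 t |>.hasDerivAt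
  have hPc : Continuous P := continuous_iff_continuousAt.2 fun t => (hPd t).continuousAt
  set G : ℝ → ℝ := fun t => g' t + P t - g₀ with hG
  have hGc : Continuous G := (hgc.add hPc).sub continuous_const
  -- The test function has as its derivative the defect G itself, times a weight that vanishes
  -- continuously at τ. Integration by parts turns the weak identity into ∫ (τ - s) G² = 0.
  set η : ℝ → ℝ := fun s => max (τ - s) 0 * G s with hη
  have hηc : Continuous η := by fun_prop
  set χ : ℝ → ℝ := fun t => ∫ s in τ..t, η s with hχ
  have hχd : ∀ t, HasDerivAt χ (η t) t := fun t => hηc.integral_hasStrictDerivAt τ t |>.hasDerivAt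
  have hχc : Continuous χ := continuous_iff_continuousAt.2 fun t => (hχd t).continuousAt
  have hη0 : ∀ t, τ ≤ t → η t = 0 := fun t ht => by simp [hη, ht]
  have hχ0 : ∀ t, τ ≤ t → χ t = 0 := fun t ht => by
    rw [hχ]
    refine intervalIntegral.integral_zero_ae (.of_forall fun s hs => ?_)
    rw [uIoc_of_le ht] at hs
    exact hη0 s hs.1.le
  have h1 := hw χ η hχd hηc τ ⟨hτ, hτT⟩ hχ0 hη0
  have h2 : ∫ t in (0 : ℝ)..τ, η t * (P t - g₀) + χ t * k' t
      = χ τ * (P τ - g₀) - χ 0 * (P 0 - g₀) :=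
    intervalIntegral.integral_eq_sub_of_hasDerivAt
      (fun t _ => (hχd t).mul ((hPd t).sub_const g₀))
      (Continuous.intervalIntegrable (by fun_prop) _ _)
  rw [hχ0 τ le_rfl, zero_mul, zero_sub, show P 0 = 0 by simp [hP], zero_sub, mul_neg, neg_neg]
    at h2
  rw [intervalIntegral.integral_congr (f := fun t => η t * g t) (g := fun t => η t * g' t) (fun t ht => by
      rw [uIcc_of_le hτ.le] at ht; simp [hgg t ht]),
    intervalIntegral.integral_congr (f := fun t => χ t * k t) (g := fun t => χ t * k' t) (fun t ht => by
      rw [uIcc_of_le hτ.le] at ht; simp [hkk t ht])] at h1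
  rw [intervalIntegral.integral_add (Continuous.intervalIntegrable (by fun_prop) _ _)
    (Continuous.intervalIntegrable (by fun_prop) _ _)] at h2
  have h3 : (∫ t in (0 : ℝ)..τ, η t * g' t) + ∫ t in (0 : ℝ)..τ, η t * (P t - g₀) = 0 := by
    linarith
  rw [← intervalIntegral.integral_add (Continuous.intervalIntegrable (by fun_prop) _ _)
    (Continuous.intervalIntegrable (by fun_prop) _ _)] at h3
  have h4 : ∫ s in (0 : ℝ)..τ, (τ - s) * G s ^ 2 = 0 := by
    refine (intervalIntegral.integral_congr fun s hs => ?_).trans h3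
    rw [uIcc_of_le hτ.le] at hs
    simp only [hη, hG, max_eq_left (sub_nonneg.2 hs.2)]
    ring
  have h5 := eq_zero_of_integral_mul_sq_eq_zero hGc h4 ⟨ht.1, htτ⟩
  have h6 : P t = ∫ s in (0 : ℝ)..t, k s :=
    intervalIntegral.integral_congr fun s hs => by
      rw [uIcc_of_le ht.1] at hs; exact hkk s ⟨hs.1, hs.2.trans htτ.le⟩
  rw [← h6, ← hgg t ⟨ht.1, htτ.le⟩]
  simp only [hG] at h5
  linarith

end DuBoisReymond

/-! ### C¹_b observables as test functions. -/

/-- A `C¹_b` function whose gradient is bounded by `Λ`. -/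
structure IsC1b (φ : Space d → ℝ) (Λ : ℝ) : Prop where
  contDiff : ContDiff ℝ 1 φ
  bounded : ∃ C, ∀ x, ‖φ x‖ ≤ C
  norm_fderiv_le : ∀ x, ‖fderiv ℝ φ x‖ ≤ Λ

namespace IsC1b

variable {φ : Space d → ℝ} {Λ : ℝ}

lemma nonneg (hφ : IsC1b φ Λ) : 0 ≤ Λ := (norm_nonneg _).trans (hφ.norm_fderiv_le 0)

lemma continuous_fderiv (hφ : IsC1b φ Λ) : Continuous (fderiv ℝ φ) :=
  hφ.contDiff.continuous_fderiv one_ne_zero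

lemma hasFDerivAt (hφ : IsC1b φ Λ) (x : Space d) : HasFDerivAt φ (fderiv ℝ φ x) x :=
  (hφ.contDiff.differentiable one_ne_zero x).hasFDerivAt

lemma integrable (hφ : IsC1b φ Λ) (μ : ProbabilityMeasure (Space d)) :
    Integrable φ (μ : Measure (Space d)) :=
  Integrable.of_bound hφ.contDiff.continuous.aestronglyMeasurable hφ.bounded.choose
    (.of_forall hφ.bounded.choose_spec)

/-- A `C¹_b` function as a bounded continuous function. -/
def toBCF (hφ : IsC1b φ Λ) : Space d →ᵇ ℝ :=
  BoundedContinuousFunction.ofNormedAddCommGroup φ hφ.contDiff.continuous hφ.bounded.choose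
    hφ.bounded.choose_spec

/-- The gradient of a `C¹_b` function as a bounded continuous function. -/
def gradBCF (hφ : IsC1b φ Λ) : Space d →ᵇ Space d :=
  BoundedContinuousFunction.ofNormedAddCommGroup
    (fun x => (InnerProductSpace.toDual ℝ (Space d)).symm (fderiv ℝ φ x))
    ((LinearIsometryEquiv.continuous _).comp hφ.continuous_fderiv) Λ
    (fun x => by rw [LinearIsometryEquiv.norm_map]; exact hφ.norm_fderiv_le x)

lemma inner_gradBCF (hφ : IsC1b φ Λ) (x v : Space d) :
    inner ℝ (hφ.gradBCF x) v = fderiv ℝ φ x v :=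
  InnerProductSpace.toDual_symm_apply

lemma hasGradientAt (hφ : IsC1b φ Λ) (x : Space d) : HasGradientAt φ (hφ.gradBCF x) x :=
  (hφ.hasFDerivAt x).hasGradientAt

/-- The test function `χ(t) φ(x)`. -/
def testFun (hφ : IsC1b φ Λ) {χ : ℝ → ℝ} (hχ : ContDiff ℝ 1 χ) {τ : ℝ} (hτ : τ < T)
    (h0 : ∀ t, τ ≤ t → χ t = 0) : TestFun d T where
  val t := χ t • hφ.toBCF
  grad t := χ t • hφ.gradBCF
  hasGradientAt t _ x := by
    rw [hasGradientAt_iff_hasFDerivAt]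
    have := (hφ.hasGradientAt x).hasFDerivAt.const_smul (χ t)
    rwa [← map_smul] at this
  contDiffOn_val := (hχ.smul contDiff_const).contDiffOn
  contDiffOn_grad := (hχ.smul contDiff_const).contDiffOn
  compact_support := ⟨τ, hτ, fun t _ ht => by simp [h0 t ht.le]⟩

end IsC1b

/-! ### Time evolution of observables along an arbitrary weak solution. -/

section WeakDerivativeInTime

variable {ρ₀ : ProbabilityMeasure (Space d)} {σ : ℝ → ProbabilityMeasure (Space d)}
  {φ : Space d → ℝ} {Λ : ℝ}

lemma IsWeakSolution.continuousOn_integral (hσ : IsWeakSolution K T ρ₀ σ) (hφ : IsC1b φ Λ) :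
    ContinuousOn (fun t => ∫ x, φ x ∂(σ t : Measure (Space d))) (Ico 0 T) :=
  continuousOn_integral_pairing (u := fun _ => hφ.toBCF) continuousOn_const hσ.narrow_continuous

lemma IsWeakSolution.continuousOn_flux (hσ : IsWeakSolution K T ρ₀ σ)
    (h : IsRegularKernel (∇ K) M L) (hφ : IsC1b φ Λ) :
    ContinuousOn (fun t => ∫ x, fderiv ℝ φ x (gradConv K (σ t) x) ∂(σ t : Measure (Space d)))
      (Ico 0 T) := by
  simp_rw [← hφ.inner_gradBCF]
  exact continuousOn_integral_inner_gradConv h continuousOn_const hσ.narrow_continuous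

/-- Product test functions χ(t)φ(x) reduce the weak equation to a scalar one in time. -/
lemma IsWeakSolution.integral_eq_sub (hσ : IsWeakSolution K T ρ₀ σ)
    (h : IsRegularKernel (∇ K) M L) (hφ : IsC1b φ Λ) {t : ℝ} (ht : t ∈ Ico 0 T) :
    ∫ x, φ x ∂(σ t : Measure (Space d)) = ∫ x, φ x ∂(ρ₀ : Measure (Space d))
      - ∫ s in (0 : ℝ)..t, ∫ x, fderiv ℝ φ x (gradConv K (σ s) x) ∂(σ s : Measure (Space d)) := by
  refine eq_sub_integral_of_weak (hσ.continuousOn_integral hφ) (hσ.continuousOn_flux h hφ)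
    (fun χ χ' hχ hχ' τ hτ h0 h0' => ?_) ht
  have hχ1 : ContDiff ℝ 1 χ := contDiff_one_iff_deriv.2
    ⟨fun t => (hχ t).differentiableAt, by rwa [show deriv χ = χ' from funext fun t => (hχ t).deriv]⟩
  have hw := hσ.weak_form (hφ.testFun hχ1 hτ.2 h0)
  have hd : ∀ t ∈ Ico 0 T, (hφ.testFun hχ1 hτ.2 h0).timeDeriv t = χ' t • hφ.toBCF := fun t ht =>
    ((hχ t).smul_const hφ.toBCF).hasDerivWithinAt.derivWithin (uniqueDiffOn_Ico 0 T t ht)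
  rw [intervalIntegral_eq_of_eq_zero hτ.1.le hτ.2.le fun t ht => by
      rw [hd t ⟨hτ.1.le.trans ht.1.le, ht.2⟩, h0' t ht.1.le]; simp,
    intervalIntegral_eq_of_eq_zero hτ.1.le hτ.2.le fun t ht => by
      simp [IsC1b.testFun, h0 t ht.1.le]] at hw
  convert hw using 2
  · congr 1
    · refine intervalIntegral.integral_congr fun t ht => ?_
      rw [uIcc_of_le hτ.1.le] at ht
      simp only [hd t ⟨ht.1, ht.2.trans_lt hτ.2⟩]
      exact (integral_const_mul _ _).symm
    · refine intervalIntegral.integral_congr fun t _ => ?_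
      change _ = ∫ x, inner ℝ (χ t • hφ.gradBCF x) (gradConv K (σ t) x) ∂(σ t : Measure (Space d))
      simp_rw [real_inner_smul_left, hφ.inner_gradBCF]
      exact (integral_const_mul _ _).symm
  · exact (integral_const_mul _ _).symm

lemma IsWeakSolution.integral_zero (hσ : IsWeakSolution K T ρ₀ σ) (h : IsRegularKernel (∇ K) M L)
    (hT : 0 < T) (hφ : IsC1b φ Λ) :
    ∫ x, φ x ∂(σ 0 : Measure (Space d)) = ∫ x, φ x ∂(ρ₀ : Measure (Space d)) := by
  simpa using hσ.integral_eq_sub h hφ ⟨le_rfl, hT⟩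

lemma IsWeakSolution.hasDerivAt_integral (hσ : IsWeakSolution K T ρ₀ σ)
    (h : IsRegularKernel (∇ K) M L) (hφ : IsC1b φ Λ) {t : ℝ} (ht : t ∈ Ioo 0 T) :
    HasDerivAt (fun t => ∫ x, φ x ∂(σ t : Measure (Space d)))
      (-∫ x, fderiv ℝ φ x (gradConv K (σ t) x) ∂(σ t : Measure (Space d))) t := by
  have hk := hσ.continuousOn_flux h hφ
  have hnhds : Ico 0 T ∈ 𝓝 t := Ico_mem_nhds ht.1 ht.2
  have hd := (intervalIntegral.integral_hasDerivAt_right (a := 0)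
    ((hk.mono ?_).intervalIntegrable)
    (hk.stronglyMeasurableAtFilter_nhdsWithin measurableSet_Ico t |>.filter_mono ?_)
    (hk.continuousAt hnhds)).const_sub (∫ x, φ x ∂(ρ₀ : Measure (Space d)))
  · refine hd.congr_of_eventuallyEq ?_
    filter_upwards [hnhds] with s hs
    exact hσ.integral_eq_sub h hφ hs
  · rw [uIcc_of_le ht.1.le]
    exact fun s hs => ⟨hs.1, hs.2.trans_lt ht.2⟩
  · exact (nhdsWithin_eq_nhds.2 hnhds).ge

lemma norm_flux_le (h : IsRegularKernel (∇ K) M L) (hφ : IsC1b φ Λ)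
    (μ : ProbabilityMeasure (Space d)) :
    ‖∫ x, fderiv ℝ φ x (gradConv K μ x) ∂(μ : Measure (Space d))‖ ≤ Λ * M := by
  have : ∀ x, ‖fderiv ℝ φ x (gradConv K μ x)‖ ≤ Λ * M := fun x =>
    (fderiv ℝ φ x).le_of_opNorm_le_of_le (hφ.norm_fderiv_le x) (norm_gradConv_le h μ x)
  simpa using norm_integral_le_of_norm_le_const (μ := (μ : Measure (Space d))) (.of_forall this)

/-- The mean value inequality on a half-open interval, for a derivative in the interior. -/
lemma abs_sub_le_of_hasDerivAt_Ioo {q q' : ℝ → ℝ} {C s t : ℝ} (hst : s < t)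
    (hq : ContinuousOn q (Icc s t)) (hq' : ∀ r ∈ Ioo s t, HasDerivAt q (q' r) r)
    (hC : ∀ r ∈ Ioo s t, |q' r| ≤ C) : |q t - q s| ≤ C * (t - s) := by
  obtain ⟨r, hr, hr'⟩ := exists_hasDerivAt_eq_slope q q' hst hq hq'
  have hpos := sub_pos.2 hst
  rw [eq_div_iff hpos.ne'] at hr'
  rw [← hr', abs_mul, abs_of_pos hpos]
  exact mul_le_mul_of_nonneg_right (hC r hr) hpos.le

lemma IsWeakSolution.abs_integral_sub_le (hσ : IsWeakSolution K T ρ₀ σ)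
    (h : IsRegularKernel (∇ K) M L) (hφ : IsC1b φ Λ) {s t : ℝ} (hs : 0 ≤ s) (hst : s ≤ t)
    (ht : t < T) :
    |∫ x, φ x ∂(σ t : Measure (Space d)) - ∫ x, φ x ∂(σ s : Measure (Space d))|
      ≤ Λ * M * (t - s) := by
  rcases hst.eq_or_lt with rfl | hst
  · simp
  · refine abs_sub_le_of_hasDerivAt_Ioo (q := fun t => ∫ x, φ x ∂(σ t : Measure (Space d))) hst
      ((hσ.continuousOn_integral hφ).mono fun r hr => ⟨hs.trans hr.1, hr.2.trans_lt ht⟩)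
      (fun r hr => hσ.hasDerivAt_integral h hφ ⟨hs.trans_lt hr.1, hr.2.trans ht⟩) fun r hr => ?_
    rw [abs_neg]
    exact norm_flux_le h hφ (σ r)

end WeakDerivativeInTime

/-! ### Differentiation when both the integrand and the measure depend on time. -/

section Diagonal

lemma hasDerivAt_diag {f f₁ f₂ : ℝ → ℝ → ℝ} {r : ℝ}
    (h₁ : ∀ᶠ v in 𝓝 (r, r), HasDerivAt (fun a => f a v.2) (f₁ v.1 v.2) v.1)
    (h₂ : ∀ᶠ v in 𝓝 (r, r), HasDerivAt (fun c => f v.1 c) (f₂ v.1 v.2) v.2)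
    (c₁ : ContinuousAt (fun v : ℝ × ℝ => f₁ v.1 v.2) (r, r))
    (c₂ : ContinuousAt (fun v : ℝ × ℝ => f₂ v.1 v.2) (r, r)) :
    HasDerivAt (fun a => f a a) (f₁ r r + f₂ r r) r := by
  have hc : Continuous fun c : ℝ => ContinuousLinearMap.toSpanSingleton ℝ c :=
    (ContinuousLinearMap.toSpanSingletonCLE (𝕜 := ℝ) (E := ℝ)).continuous
  have key : HasStrictFDerivAt (fun p : ℝ × ℝ => f p.1 p.2)
      ((ContinuousLinearMap.toSpanSingleton ℝ (f₁ r r)).coprod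
        (ContinuousLinearMap.toSpanSingleton ℝ (f₂ r r))) (r, r) :=
    hasStrictFDerivAt_uncurry_coprod (𝕜 := ℝ) (f := f) (u := (r, r))
    (f₁ := fun a c => ContinuousLinearMap.toSpanSingleton ℝ (f₁ a c))
    (f₂ := fun a c => ContinuousLinearMap.toSpanSingleton ℝ (f₂ a c))
    (h₁.mono fun v hv => hv.hasFDerivAt) (h₂.mono fun v hv => hv.hasFDerivAt)
    (hc.continuousAt.comp c₁) (hc.continuousAt.comp c₂)
  have := key.hasFDerivAt.comp_hasDerivAt (f := fun a => (a, a)) r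
    ((hasDerivAt_id r).prodMk (hasDerivAt_id r))
  refine this.congr_deriv ?_
  simp

/-- Continuity of integrals of a continuous function with a parameter against a narrowly convergent
family of measures. -/
lemma tendsto_integral_param {ι X : Type*} [TopologicalSpace X] [MeasurableSpace X]
    [OpensMeasurableSpace X] [SecondCountableTopology X]
    [TopologicalSpace.PseudoMetrizableSpace X] {l : Filter ι} {G : ℝ × X → ℝ} (hG : Continuous G)
    {a₀ C : ℝ} (hC : ∀ a ∈ Icc (a₀ - 1) (a₀ + 1), ∀ x, ‖G (a, x)‖ ≤ C) {a : ι → ℝ}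
    (ha : Tendsto a l (𝓝 a₀)) {μ : ι → ProbabilityMeasure X} {μ₀ : ProbabilityMeasure X}
    (hμ : Tendsto μ l (𝓝 μ₀)) :
    Tendsto (fun i => ∫ x, G (a i, x) ∂(μ i : Measure X)) l
      (𝓝 (∫ x, G (a₀, x) ∂(μ₀ : Measure X))) := by
  have hle : a₀ - 1 ≤ a₀ + 1 := by linarith
  -- The parameter becomes a Dirac factor in a product measure. Since G is bounded only for
  -- parameters near a₀, the parameter is clamped to that interval.
  let G' : ℝ × X →ᵇ ℝ := BoundedContinuousFunction.ofNormedAddCommGroup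
    (fun p => G (projIcc _ _ hle p.1, p.2))
    (hG.comp ((continuous_subtype_val.comp (continuous_projIcc.comp continuous_fst)).prodMk
      continuous_snd)) C (fun p => hC _ (projIcc _ _ hle p.1).2 _)
  have hint : ∀ b (ν : ProbabilityMeasure X), b ∈ Icc (a₀ - 1) (a₀ + 1) →
      ∫ p, G' p ∂(((diracProba b).prod ν : ProbabilityMeasure _) : Measure (ℝ × X))
        = ∫ x, G (b, x) ∂(ν : Measure X) := by
    intro b ν hb
    rw [ProbabilityMeasure.toMeasure_prod, integral_prod _ (by
      rw [← ProbabilityMeasure.toMeasure_prod]; exact G'.integrable _)]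
    refine (integral_dirac _ _).trans (integral_congr_ae (.of_forall fun x => ?_))
    change G (projIcc _ _ hle b, x) = _
    rw [projIcc_of_mem hle hb]
  have hmem : Icc (a₀ - 1) (a₀ + 1) ∈ 𝓝 a₀ := Icc_mem_nhds (by linarith) (by linarith)
  rw [← hint a₀ μ₀ (mem_of_mem_nhds hmem)]
  refine (ProbabilityMeasure.tendsto_iff_forall_integral_tendsto.1
    ((ProbabilityMeasure.continuous_prod.tendsto (diracProba a₀, μ₀)).comp
      (((continuous_diracProba.tendsto a₀).comp ha).prodMk_nhds hμ)) G').congr' ?_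
  filter_upwards [ha hmem] with i hi
  exact hint _ _ hi

end Diagonal

/-! ### Comparison with an Euler step. -/

section Transport

variable {φ : Space d → ℝ} {Λ : ℝ} {B : Space d → Space d}

lemma hasFDerivAt_add_smul (hB : ContDiff ℝ 1 B) (s : ℝ) (x : Space d) :
    HasFDerivAt (fun x => x + s • B x)
      (ContinuousLinearMap.id ℝ (Space d) + s • fderiv ℝ B x) x :=
  (hasFDerivAt_id x).add ((hB.differentiable one_ne_zero x).hasFDerivAt.const_smul s)

lemma fderiv_comp_add_smul (hφ : IsC1b φ Λ) (hB : ContDiff ℝ 1 B) (s : ℝ) (x v : Space d) :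
    fderiv ℝ (fun x => φ (x + s • B x)) x v
      = fderiv ℝ φ (x + s • B x) (v + s • fderiv ℝ B x v) := by
  have := (hφ.hasFDerivAt (x + s • B x)).comp x (hasFDerivAt_add_smul hB s x)
  rw [show (fun x => φ (x + s • B x)) = φ ∘ fun x => x + s • B x from rfl, this.fderiv]
  simp

/-- Transported observables must remain C¹_b to be tested again, which is why the field B has to be
C¹ and not just Lipschitz. -/
lemma IsC1b.comp_add_smul (hφ : IsC1b φ Λ) (hB : ContDiff ℝ 1 B)
    (hBL : ∀ x, ‖fderiv ℝ B x‖ ≤ L) (s : ℝ) :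
    IsC1b (fun x => φ (x + s • B x)) (Λ * (1 + |s| * L)) := by
  have hL : 0 ≤ L := (norm_nonneg _).trans (hBL 0)
  have hΛ := hφ.nonneg
  refine ⟨hφ.contDiff.comp (contDiff_id.add (hB.const_smul s)), ?_, fun x => ?_⟩
  · obtain ⟨C, hC⟩ := hφ.bounded
    exact ⟨C, fun x => hC _⟩
  · refine ContinuousLinearMap.opNorm_le_bound _ (by positivity) fun v => ?_
    rw [fderiv_comp_add_smul hφ hB]
    have h1 : ‖v + s • fderiv ℝ B x v‖ ≤ (1 + |s| * L) * ‖v‖ := by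
      refine (norm_add_le _ _).trans ?_
      rw [norm_smul, Real.norm_eq_abs, add_mul, one_mul, mul_assoc]
      gcongr
      exact (fderiv ℝ B x).le_of_opNorm_le (hBL x) v
    calc _ ≤ Λ * ((1 + |s| * L) * ‖v‖) :=
          (fderiv ℝ φ _).le_of_opNorm_le_of_le (hφ.norm_fderiv_le _) h1
      _ = _ := by ring

lemma hasDerivAt_integral_comp_add_smul (hφ : IsC1b φ Λ) (hB : ContDiff ℝ 1 B)
    (hBM : ∀ x, ‖B x‖ ≤ M) (t a : ℝ) (μ : ProbabilityMeasure (Space d)) :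
    HasDerivAt (fun a => ∫ x, φ (x + (t - a) • B x) ∂(μ : Measure (Space d)))
      (∫ x, -fderiv ℝ φ (x + (t - a) • B x) (B x) ∂(μ : Measure (Space d))) a := by
  have hBc := hB.continuous
  have hφc := hφ.contDiff.continuous
  have hφd := hφ.continuous_fderiv
  obtain ⟨C, hC⟩ := hφ.bounded
  refine (hasDerivAt_integral_of_dominated_loc_of_deriv_le (μ := (μ : Measure (Space d)))
    (F := fun a x => φ (x + (t - a) • B x))
    (F' := fun a x => -fderiv ℝ φ (x + (t - a) • B x) (B x)) (bound := fun _ => Λ * M)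
    (univ_mem : univ ∈ 𝓝 a)
    (.of_forall fun a => Continuous.aestronglyMeasurable (by fun_prop))
    (Integrable.of_bound (Continuous.aestronglyMeasurable (by fun_prop)) C
      (.of_forall fun x => hC _))
    (Continuous.aestronglyMeasurable (by fun_prop)) (.of_forall fun x a _ => ?_)
    (integrable_const _) (.of_forall fun x a _ => ?_)).2
  · rw [norm_neg]
    exact (fderiv ℝ φ _).le_of_opNorm_le_of_le (hφ.norm_fderiv_le _) (hBM x)
  · have h1 : HasDerivAt (fun a => x + (t - a) • B x) ((-1 : ℝ) • B x) a :=
      (((hasDerivAt_id a).const_sub t).smul_const (B x)).const_add x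
    refine ((hφ.hasFDerivAt _).comp_hasDerivAt a h1).congr_deriv ?_
    simp

lemma integral_clm_gradConv (h : IsRegularKernel (∇ K) M L) {ℓ : Space d → Space d →L[ℝ] ℝ}
    (hℓ : Continuous ℓ) {C : ℝ} (hC : ∀ x, ‖ℓ x‖ ≤ C) (μ : ProbabilityMeasure (Space d)) :
    ∫ x, ℓ x (gradConv K μ x) ∂(μ : Measure (Space d))
      = ∫ p, ℓ p.1 (∇ K (p.1 - p.2))
        ∂((μ.prod μ : ProbabilityMeasure _) : Measure (Space d × Space d)) := by
  have hKc := h.continuous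
  rw [ProbabilityMeasure.toMeasure_prod, integral_prod]
  · refine integral_congr_ae (.of_forall fun x => ?_)
    exact ((ℓ x).integral_comp_comm
      (h.integrable (μ := (μ : Measure (Space d))) (g := fun y => x - y) (by fun_prop))).symm
  · refine Integrable.of_bound (Continuous.aestronglyMeasurable (by fun_prop)) (C * M)
      (.of_forall fun p => (ℓ p.1).le_of_opNorm_le_of_le (hC _) (h.norm_le _))

variable {ρ₀ : ProbabilityMeasure (Space d)} {σ : ℝ → ProbabilityMeasure (Space d)}

lemma IsWeakSolution.hasDerivAt_transport (hσ : IsWeakSolution K T ρ₀ σ)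
    (h : IsRegularKernel (∇ K) M L) (hφ : IsC1b φ Λ) (hB : ContDiff ℝ 1 B)
    (hBM : ∀ x, ‖B x‖ ≤ M) (hBL : ∀ x, ‖fderiv ℝ B x‖ ≤ L) (t : ℝ) {r : ℝ} (hr : r ∈ Ioo 0 T) :
    HasDerivAt (fun r => ∫ x, φ (x + (t - r) • B x) ∂(σ r : Measure (Space d)))
      ((∫ x, -fderiv ℝ φ (x + (t - r) • B x) (B x) ∂(σ r : Measure (Space d)))
        + -∫ x, fderiv ℝ (fun x => φ (x + (t - r) • B x)) x (gradConv K (σ r) x)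
          ∂(σ r : Measure (Space d))) r := by
  have hKc := h.continuous
  have hBc := hB.continuous
  have hBd := hB.continuous_fderiv one_ne_zero
  have hφd := hφ.continuous_fderiv
  have hL := h.lipschitz_pos
  have hΛ := hφ.nonneg
  have hσr : Tendsto (fun v : ℝ × ℝ => σ v.2) (𝓝 (r, r)) (𝓝 (σ r)) :=
    (hσ.narrow_continuous.continuousAt (Ico_mem_nhds hr.1 hr.2)).tendsto.comp
      (continuous_snd.tendsto (r, r))
  have ha : Tendsto (fun v : ℝ × ℝ => v.1) (𝓝 (r, r)) (𝓝 r) := continuous_fst.tendsto (r, r)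
  refine hasDerivAt_diag (f := fun a c => ∫ x, φ (x + (t - a) • B x) ∂(σ c : Measure (Space d)))
    (f₁ := fun a c => ∫ x, -fderiv ℝ φ (x + (t - a) • B x) (B x) ∂(σ c : Measure (Space d)))
    (f₂ := fun a c => -∫ x, fderiv ℝ (fun x => φ (x + (t - a) • B x)) x (gradConv K (σ c) x)
      ∂(σ c : Measure (Space d)))
    (.of_forall fun v => hasDerivAt_integral_comp_add_smul hφ hB hBM t v.1 (σ v.2)) ?_ ?_ ?_
  · filter_upwards [continuous_snd.continuousAt (Ioo_mem_nhds hr.1 hr.2)] with v hv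
    exact hσ.hasDerivAt_integral h (hφ.comp_add_smul hB hBL (t - v.1)) hv
  · exact tendsto_integral_param
      (G := fun p : ℝ × Space d => -fderiv ℝ φ (p.2 + (t - p.1) • B p.2) (B p.2)) (by fun_prop)
      (C := Λ * M) (fun a _ x => by
        rw [norm_neg]
        exact (fderiv ℝ φ _).le_of_opNorm_le_of_le (hφ.norm_fderiv_le _) (hBM x)) ha hσr
  · refine Tendsto.neg ?_
    have hC1 := fun a : ℝ => hφ.comp_add_smul hB hBL (t - a)
    have heq : ∀ a c : ℝ, ∫ x, fderiv ℝ (fun x => φ (x + (t - a) • B x)) x (gradConv K (σ c) x)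
          ∂(σ c : Measure (Space d))
        = ∫ p, fderiv ℝ φ (p.1 + (t - a) • B p.1)
            (∇ K (p.1 - p.2) + (t - a) • fderiv ℝ B p.1 (∇ K (p.1 - p.2)))
          ∂(((σ c).prod (σ c) : ProbabilityMeasure _) : Measure (Space d × Space d)) := by
      intro a c
      rw [integral_clm_gradConv h (hC1 a).continuous_fderiv (hC1 a).norm_fderiv_le]
      simp_rw [fderiv_comp_add_smul hφ hB]
    simp_rw [heq]
    refine tendsto_integral_param
      (G := fun p : ℝ × (Space d × Space d) => fderiv ℝ φ (p.2.1 + (t - p.1) • B p.2.1)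
            (∇ K (p.2.1 - p.2.2) + (t - p.1) • fderiv ℝ B p.2.1 (∇ K (p.2.1 - p.2.2))))
      -- The extra 1 covers parameters a within distance one of r.
      (by fun_prop) (C := Λ * (1 + (|t - r| + 1) * L) * M) (fun a ha p => ?_) ha
      ((ProbabilityMeasure.continuous_prod.tendsto (σ r, σ r)).comp (hσr.prodMk_nhds hσr))
    simp only
    rw [← fderiv_comp_add_smul hφ hB]
    refine (fderiv ℝ _ p.1).le_of_opNorm_le_of_le (((hC1 a).norm_fderiv_le _).trans ?_)
      (h.norm_le _)
    have : |t - a| ≤ |t - r| + 1 := by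
      have h1 : |r - a| ≤ 1 := abs_le.2 ⟨by linarith [ha.2], by linarith [ha.1]⟩
      calc |t - a| = |(t - r) + (r - a)| := by ring_nf
        _ ≤ |t - r| + 1 := (abs_add_le _ _).trans (by linarith)
    gcongr

/-- Comparison of a weak solution with one explicit Euler step along the field `B`. -/
lemma IsWeakSolution.abs_integral_sub_transport_le (hσ : IsWeakSolution K T ρ₀ σ)
    (h : IsRegularKernel (∇ K) M L) (hφ : IsC1b φ Λ) (hB : ContDiff ℝ 1 B)
    (hBM : ∀ x, ‖B x‖ ≤ M) (hBL : ∀ x, ‖fderiv ℝ B x‖ ≤ L) {s t κ : ℝ} (hs : 0 ≤ s) (hst : s < t)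
    (ht : t < T) (hκ : ∀ r ∈ Ioo s t, ∀ x, ‖gradConv K (σ r) x + B x‖ ≤ κ) :
    |∫ x, φ x ∂(σ t : Measure (Space d))
      - ∫ x, φ (x + (t - s) • B x) ∂(σ s : Measure (Space d))|
      ≤ Λ * (κ + (t - s) * (L * M)) * (t - s) := by
  have hΛ := hφ.nonneg
  have hL := h.lipschitz_pos
  have hM := h.bound_nonneg
  have hφd := hφ.continuous_fderiv
  have hBc := hB.continuous
  -- The interpolation r ↦ ∫ φ(x + (t - r)B) dσ(r) joins the two integrals. In its derivative the
  -- field of σ(r) nearly cancels B, up to κ; the rest is the term (t - r)DB applied to that field.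
  have key := abs_sub_le_of_hasDerivAt_Ioo (C := Λ * (κ + (t - s) * (L * M)))
    (q := fun r => ∫ x, φ (x + (t - r) • B x) ∂(σ r : Measure (Space d))) hst ?_
    (fun r hr => hσ.hasDerivAt_transport h hφ hB hBM hBL t ⟨hs.trans_lt hr.1, hr.2.trans ht⟩) ?_
  · simpa using key
  · intro r hr
    have hsub : Icc s t ⊆ Ico 0 T := fun r hr => ⟨hs.trans hr.1, hr.2.trans_lt ht⟩
    obtain ⟨C, hC⟩ := hφ.bounded
    have hφc := hφ.contDiff.continuous
    exact tendsto_integral_param (G := fun p : ℝ × Space d => φ (p.2 + (t - p.1) • B p.2))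
      (by fun_prop) (C := C) (fun a _ x => hC _) (tendsto_id.mono_left nhdsWithin_le_nhds)
      (hσ.narrow_continuous.mono hsub r hr)
  · intro r hr
    have hC1 := hφ.comp_add_smul hB hBL (t - r)
    have hpt : ∀ x, ‖-fderiv ℝ φ (x + (t - r) • B x) (B x)
        - fderiv ℝ (fun x => φ (x + (t - r) • B x)) x (gradConv K (σ r) x)‖
        ≤ Λ * (κ + (t - s) * (L * M)) := by
      intro x
      rw [fderiv_comp_add_smul hφ hB, ← map_neg, ← map_sub]
      refine (fderiv ℝ φ _).le_of_opNorm_le_of_le (hφ.norm_fderiv_le _) ?_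
      have h1 : ‖(t - r) • fderiv ℝ B x (gradConv K (σ r) x)‖ ≤ (t - s) * (L * M) := by
        rw [norm_smul, Real.norm_of_nonneg (sub_nonneg.2 hr.2.le)]
        refine mul_le_mul (by linarith [hr.1])
          ((fderiv ℝ B x).le_of_opNorm_le_of_le (hBL x) (norm_gradConv_le h _ _)) (norm_nonneg _)
          (by linarith)
      calc ‖-B x - (gradConv K (σ r) x + (t - r) • fderiv ℝ B x (gradConv K (σ r) x))‖
          = ‖(gradConv K (σ r) x + B x) + (t - r) • fderiv ℝ B x (gradConv K (σ r) x)‖ := by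
            rw [← norm_neg]; congr 1; abel
        _ ≤ κ + (t - s) * (L * M) := (norm_add_le _ _).trans (add_le_add (hκ r hr x) h1)
    rw [← sub_eq_add_neg, ← integral_sub]
    · simpa using norm_integral_le_of_norm_le_const (μ := (σ r : Measure (Space d)))
        (.of_forall hpt)
    · exact Integrable.of_bound (Continuous.aestronglyMeasurable (by fun_prop)) (Λ * M)
        (.of_forall fun x => by
          rw [norm_neg]
          exact (fderiv ℝ φ _).le_of_opNorm_le_of_le (hφ.norm_fderiv_le _) (hBM x))
    · exact Integrable.of_bound (hC1.continuous_fderiv.clm_apply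
        (continuous_gradConv h _)).aestronglyMeasurable _ (.of_forall fun x =>
          (fderiv ℝ _ x).le_of_opNorm_le_of_le (hC1.norm_fderiv_le x) (norm_gradConv_le h _ x))

end Transport

/-! ### Convolution with a C¹ kernel. -/

section SmoothConvolution

variable {G : Space d → Space d}

lemma hasFDerivAt_integral_sub (hG : ContDiff ℝ 1 G) (hGM : ∀ x, ‖G x‖ ≤ M)
    (hGL : ∀ x, ‖fderiv ℝ G x‖ ≤ L) (μ : ProbabilityMeasure (Space d)) (x : Space d) :
    HasFDerivAt (fun x => ∫ y, G (x - y) ∂(μ : Measure (Space d)))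
      (∫ y, fderiv ℝ G (x - y) ∂(μ : Measure (Space d))) x := by
  have hGc := hG.continuous
  have hGd := hG.continuous_fderiv one_ne_zero
  exact hasFDerivAt_integral_of_dominated_of_fderiv_le (μ := (μ : Measure (Space d)))
    (F := fun x y => G (x - y)) (F' := fun x y => fderiv ℝ G (x - y)) (bound := fun _ => L)
    (univ_mem : univ ∈ 𝓝 x)
    (.of_forall fun a => Continuous.aestronglyMeasurable (by fun_prop))
    (Integrable.of_bound (Continuous.aestronglyMeasurable (by fun_prop)) M
      (.of_forall fun y => hGM _))
    (Continuous.aestronglyMeasurable (by fun_prop)) (.of_forall fun y a _ => hGL _)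
    (integrable_const _) (.of_forall fun y a _ =>
      (hasFDerivAt_comp_sub y).2 (hG.differentiable one_ne_zero (a - y)).hasFDerivAt)

lemma contDiff_integral_sub (hG : ContDiff ℝ 1 G) (hGM : ∀ x, ‖G x‖ ≤ M)
    (hGL : ∀ x, ‖fderiv ℝ G x‖ ≤ L) (μ : ProbabilityMeasure (Space d)) :
    ContDiff ℝ 1 (fun x => ∫ y, G (x - y) ∂(μ : Measure (Space d))) := by
  have hGd := hG.continuous_fderiv one_ne_zero
  have hd := hasFDerivAt_integral_sub hG hGM hGL μ
  refine contDiff_one_iff_fderiv.2 ⟨fun x => (hd x).differentiableAt, ?_⟩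
  rw [funext fun x => (hd x).fderiv]
  exact continuous_of_dominated (bound := fun _ => L)
    (fun x => Continuous.aestronglyMeasurable (by fun_prop)) (fun x => .of_forall fun y => hGL _)
    (integrable_const _) (.of_forall fun y => by fun_prop)

lemma norm_fderiv_integral_sub_le (hG : ContDiff ℝ 1 G) (hGM : ∀ x, ‖G x‖ ≤ M)
    (hGL : ∀ x, ‖fderiv ℝ G x‖ ≤ L) (μ : ProbabilityMeasure (Space d)) (x : Space d) :
    ‖fderiv ℝ (fun x => ∫ y, G (x - y) ∂(μ : Measure (Space d))) x‖ ≤ L := by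
  rw [(hasFDerivAt_integral_sub hG hGM hGL μ x).fderiv]
  simpa using norm_integral_le_of_norm_le_const (μ := (μ : Measure (Space d)))
    (.of_forall fun y => hGL (x - y))

lemma isC1b_inner_sub (hG : ContDiff ℝ 1 G) (hGM : ∀ x, ‖G x‖ ≤ M)
    (hGL : ∀ x, ‖fderiv ℝ G x‖ ≤ L) (e x : Space d) :
    IsC1b (fun y => inner ℝ e (G (x - y))) (‖e‖ * L) := by
  refine ⟨contDiff_const.inner ℝ (hG.comp (contDiff_const.sub contDiff_id)),
    ⟨‖e‖ * M, fun y => (norm_inner_le_norm _ _).trans (by gcongr; exact hGM _)⟩, fun y => ?_⟩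
  have h1 : HasFDerivAt (fun y => G (x - y))
      ((fderiv ℝ G (x - y)).comp (-ContinuousLinearMap.id ℝ (Space d))) y :=
    HasFDerivAt.comp y (hG.differentiable one_ne_zero _).hasFDerivAt
      ((hasFDerivAt_id y).const_sub x)
  have h2 : HasFDerivAt (fun y => inner ℝ e (G (x - y))) _ y :=
    (innerSL ℝ e).hasFDerivAt.comp y h1
  rw [h2.fderiv]
  refine (ContinuousLinearMap.opNorm_comp_le _ _).trans ?_
  rw [innerSL_apply_norm]
  gcongr
  rw [ContinuousLinearMap.comp_neg, ContinuousLinearMap.comp_id, norm_neg]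
  exact hGL _

end SmoothConvolution

/-! ### The distance dual to C¹_b. -/

section DualDistance

variable {μ ν : ProbabilityMeasure (Space d)} {φ : Space d → ℝ} {Λ D : ℝ}

lemma isC1b_zero : IsC1b (fun _ : Space d => (0 : ℝ)) 1 :=
  ⟨contDiff_const, ⟨0, by simp⟩, by simp⟩

lemma IsC1b.inv_smul (hφ : IsC1b φ Λ) (hΛ : 0 < Λ) : IsC1b (fun x => Λ⁻¹ * φ x) 1 := by
  obtain ⟨C, hC⟩ := hφ.bounded
  refine ⟨contDiff_const.mul hφ.contDiff, ⟨Λ⁻¹ * C, fun x => ?_⟩, fun x => ?_⟩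
  · rw [norm_mul, Real.norm_of_nonneg (by positivity)]
    gcongr
    exact hC x
  · rw [((hφ.hasFDerivAt x).const_mul Λ⁻¹).fderiv, norm_smul, Real.norm_of_nonneg (by positivity),
      inv_mul_le_iff₀ hΛ, mul_one]
    exact hφ.norm_fderiv_le x

/-- `μ` and `ν` are at distance at most `D` in duality with `C¹_b`, with respect to the supremum
norm of the gradient. -/
def DualDistLE (μ ν : ProbabilityMeasure (Space d)) (D : ℝ) : Prop :=
  ∀ φ : Space d → ℝ, IsC1b φ 1 →
    |∫ x, φ x ∂(μ : Measure (Space d)) - ∫ x, φ x ∂(ν : Measure (Space d))| ≤ D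

lemma DualDistLE.abs_sub_le (hD : DualDistLE μ ν D) (hφ : IsC1b φ Λ) (hΛ : 0 < Λ) :
    |∫ x, φ x ∂(μ : Measure (Space d)) - ∫ x, φ x ∂(ν : Measure (Space d))| ≤ Λ * D := by
  have := hD _ (hφ.inv_smul hΛ)
  rwa [integral_const_mul, integral_const_mul, ← mul_sub, abs_mul, abs_of_pos (inv_pos.2 hΛ),
    inv_mul_le_iff₀ hΛ] at this

lemma DualDistLE.nonneg (hD : DualDistLE μ ν D) : 0 ≤ D := by
  simpa using hD _ isC1b_zero

/-- The distance in duality with `C¹_b` functions of gradient at most one. -/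
def dualDist (μ ν : ProbabilityMeasure (Space d)) : ℝ :=
  sInf {D | DualDistLE μ ν D}

lemma DualDistLE.dualDist_le (hD : DualDistLE μ ν D) : dualDist μ ν ≤ D :=
  csInf_le ⟨0, fun _ h => h.nonneg⟩ hD

/-- A finite bound is needed first: the real infimum of the empty set is 0. -/
lemma DualDistLE.dualDistLE_dualDist (hD : DualDistLE μ ν D) : DualDistLE μ ν (dualDist μ ν) :=
  fun φ hφ => le_csInf ⟨D, hD⟩ fun _ h => h φ hφ

lemma DualDistLE.triangle {π : ProbabilityMeasure (Space d)} {D' : ℝ} (hD : DualDistLE μ ν D)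
    (hD' : DualDistLE ν π D') : DualDistLE μ π (D + D') := fun φ hφ =>
  (_root_.abs_sub_le _ _ _).trans (add_le_add (hD φ hφ) (hD' φ hφ))

lemma DualDistLE.symm (hD : DualDistLE μ ν D) : DualDistLE ν μ D := fun φ hφ => by
  rw [abs_sub_comm]; exact hD φ hφ

/-- The difference v is tested against its own direction: y ↦ ⟨v, G(x - y)⟩ has gradient at most
‖v‖L, giving ‖v‖² ≤ ‖v‖LD. -/
lemma DualDistLE.norm_integral_sub_le {G : Space d → Space d} (hG : ContDiff ℝ 1 G)
    (hGM : ∀ x, ‖G x‖ ≤ M) (hL : 0 < L) (hGL : ∀ x, ‖fderiv ℝ G x‖ ≤ L) (hD : DualDistLE μ ν D)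
    (x : Space d) :
    ‖∫ y, G (x - y) ∂(μ : Measure (Space d)) - ∫ y, G (x - y) ∂(ν : Measure (Space d))‖
      ≤ L * D := by
  have hD0 := hD.nonneg
  have hGc := hG.continuous
  set v := ∫ y, G (x - y) ∂(μ : Measure (Space d)) - ∫ y, G (x - y) ∂(ν : Measure (Space d)) with hv
  have hint : ∀ π : ProbabilityMeasure (Space d),
      Integrable (fun y => G (x - y)) (π : Measure (Space d)) := fun π =>
    Integrable.of_bound (Continuous.aestronglyMeasurable (by fun_prop)) M
      (.of_forall fun y => hGM _)
  rcases eq_or_ne v 0 with h0 | h0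
  · rw [h0, norm_zero]; positivity
  have hpos : 0 < ‖v‖ := norm_pos_iff.2 h0
  have h1 := hD.abs_sub_le (isC1b_inner_sub hG hGM hGL v x) (by positivity)
  rw [integral_inner (hint μ), integral_inner (hint ν), ← inner_sub_right, ← hv,
    real_inner_self_eq_norm_sq, abs_of_nonneg (by positivity)] at h1
  nlinarith

/-- Measures at distance zero in duality with `C¹_b` have the same characteristic function. -/
lemma DualDistLE.eq (hD : DualDistLE μ ν 0) : μ = ν := by
  suffices hξ : ∀ ξ, charFun (μ : Measure (Space d)) ξ = charFun (ν : Measure (Space d)) ξ from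
    Subtype.ext (Measure.ext_of_charFun (μ := (μ : Measure (Space d)))
      (ν := (ν : Measure (Space d))) (funext hξ))
  intro ξ
  have hlin : ∀ x, HasFDerivAt (fun x : Space d => inner ℝ x ξ) ((innerSL ℝ ξ)) x := fun x => by
    simpa [real_inner_comm] using (innerSL ℝ ξ).hasFDerivAt (x := x)
  have hcd : ContDiff ℝ 1 (fun x : Space d => inner ℝ x ξ) := contDiff_id.inner ℝ contDiff_const
  -- The added 1 keeps the gradient bound positive at ξ = 0, as the rescaling requires.
  have hcos : IsC1b (fun x : Space d => Real.cos (inner ℝ x ξ)) (‖ξ‖ + 1) := by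
    refine ⟨hcd.cos, ⟨1, fun x => Real.abs_cos_le_one _⟩, fun x => ?_⟩
    rw [(hlin x).cos.fderiv, norm_smul, innerSL_apply_norm, norm_neg]
    nlinarith [Real.abs_sin_le_one (inner ℝ x ξ), norm_nonneg ξ,
      Real.norm_eq_abs (Real.sin (inner ℝ x ξ))]
  have hsin : IsC1b (fun x : Space d => Real.sin (inner ℝ x ξ)) (‖ξ‖ + 1) := by
    refine ⟨hcd.sin, ⟨1, fun x => Real.abs_sin_le_one _⟩, fun x => ?_⟩
    rw [(hlin x).sin.fderiv, norm_smul, innerSL_apply_norm]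
    nlinarith [Real.abs_cos_le_one (inner ℝ x ξ), norm_nonneg ξ,
      Real.norm_eq_abs (Real.cos (inner ℝ x ξ))]
  have heq : ∀ {φ : Space d → ℝ}, IsC1b φ (‖ξ‖ + 1) →
      ∫ x, φ x ∂(μ : Measure (Space d)) = ∫ x, φ x ∂(ν : Measure (Space d)) := fun hφ => by
    have := hD.abs_sub_le hφ (by positivity)
    rw [mul_zero] at this
    exact sub_eq_zero.1 (abs_nonpos_iff.1 this)
  have hsplit : ∀ π : ProbabilityMeasure (Space d), charFun (π : Measure (Space d)) ξ
      = ((∫ x, Real.cos (inner ℝ x ξ) ∂(π : Measure (Space d)) : ℝ) : ℂ)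
        + ((∫ x, Real.sin (inner ℝ x ξ) ∂(π : Measure (Space d)) : ℝ) : ℂ) * Complex.I := by
    intro π
    rw [charFun_apply, ← integral_complex_ofReal, ← integral_complex_ofReal, ← integral_mul_const,
      ← integral_add (hcos.integrable π).ofReal ((hsin.integrable π).ofReal.mul_const _)]
    simp_rw [Complex.exp_mul_I, Complex.ofReal_cos, Complex.ofReal_sin]
  rw [hsplit μ, hsplit ν, heq hcos, heq hsin]

end DualDistance

/-! ### Stability and uniqueness of weak solutions. -/

section Uniqueness

variable {ρ₀ : ProbabilityMeasure (Space d)} {σ ρ : ℝ → ProbabilityMeasure (Space d)}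

lemma IsWeakSolution.dualDistLE_self (hσ : IsWeakSolution K T ρ₀ σ)
    (h : IsRegularKernel (∇ K) M L) {s t : ℝ} (hs : 0 ≤ s) (hst : s ≤ t) (ht : t < T) :
    DualDistLE (σ t) (σ s) (M * (t - s)) := fun φ hφ => by
  simpa using hσ.abs_integral_sub_le h hφ hs hst ht

/-- Each solution moves away from the common initial datum at speed at most M, so the distance is
finite without any moment assumption. -/
lemma IsWeakSolution.dualDistLE (hσ : IsWeakSolution K T ρ₀ σ) (hρ : IsWeakSolution K T ρ₀ ρ)
    (h : IsRegularKernel (∇ K) M L) {t : ℝ} (ht : t ∈ Ico 0 T) :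
    DualDistLE (σ t) (ρ t) (M * t + M * t) := by
  have hT := ht.1.trans_lt ht.2
  have h0 : DualDistLE (σ 0) (ρ 0) 0 := fun φ hφ => by
    rw [hσ.integral_zero h hT hφ, hρ.integral_zero h hT hφ]; simp
  simpa using ((hσ.dualDistLE_self h le_rfl ht.1 ht.2).triangle h0).triangle
    (hρ.dualDistLE_self h le_rfl ht.1 ht.2).symm

lemma IsWeakSolution.dualDist_zero (hσ : IsWeakSolution K T ρ₀ σ) (hρ : IsWeakSolution K T ρ₀ ρ)
    (h : IsRegularKernel (∇ K) M L) (hT : 0 < T) : dualDist (σ 0) (ρ 0) ≤ 0 := by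
  simpa using (hσ.dualDistLE hρ h ⟨le_rfl, hT⟩).dualDist_le

lemma IsWeakSolution.dualDist_le_of_mem (hσ : IsWeakSolution K T ρ₀ σ)
    (hρ : IsWeakSolution K T ρ₀ ρ) (h : IsRegularKernel (∇ K) M L) {s t : ℝ}
    (hs : s ∈ Ico 0 T) (ht : t ∈ Ico 0 T) :
    dualDist (σ t) (ρ t) ≤ dualDist (σ s) (ρ s) + 2 * M * |t - s| := by
  have hdist : ∀ {π : ℝ → ProbabilityMeasure (Space d)}, IsWeakSolution K T ρ₀ π →
      DualDistLE (π t) (π s) (M * |t - s|) := fun hπ => by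
    rcases le_total s t with hst | hst
    · rw [abs_of_nonneg (sub_nonneg.2 hst)]
      exact hπ.dualDistLE_self h hs.1 hst ht.2
    · rw [abs_sub_comm, abs_of_nonneg (sub_nonneg.2 hst)]
      exact (hπ.dualDistLE_self h ht.1 hst hs.2).symm
  have := (((hdist hσ).triangle (hσ.dualDistLE hρ h hs).dualDistLE_dualDist).triangle
    (hdist hρ).symm).dualDist_le
  linarith

lemma IsWeakSolution.continuousOn_dualDist (hσ : IsWeakSolution K T ρ₀ σ)
    (hρ : IsWeakSolution K T ρ₀ ρ) (h : IsRegularKernel (∇ K) M L) :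
    ContinuousOn (fun t => dualDist (σ t) (ρ t)) (Ico 0 T) := by
  have hM := h.bound_nonneg
  refine (LipschitzOnWith.of_dist_le_mul (K := (2 * M).toNNReal) fun t ht s hs => ?_).continuousOn
  rw [Real.dist_eq, Real.dist_eq, Real.coe_toNNReal _ (by positivity), abs_sub_le_iff]
  have h1 := hσ.dualDist_le_of_mem hρ h hs ht
  have h2 := hσ.dualDist_le_of_mem hρ h ht hs
  rw [abs_sub_comm] at h2
  constructor <;> linarith

/-- Stability of weak solutions over one time step. -/
lemma IsWeakSolution.dualDist_step (hσ : IsWeakSolution K T ρ₀ σ) (hρ : IsWeakSolution K T ρ₀ ρ)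
    (h : IsRegularKernel (∇ K) M L) {s t : ℝ} (hs : 0 ≤ s) (hst : s < t) (ht : t < T) :
    dualDist (σ t) (ρ t)
      ≤ (1 + 2 * L * (t - s)) * dualDist (σ s) (ρ s) + 4 * L * M * (t - s) ^ 2 := by
  have hL := h.lipschitz_pos
  have hM := h.bound_nonneg
  have hts := sub_pos.2 hst
  have ha := (hσ.dualDistLE hρ h ⟨hs, hst.trans ht⟩).dualDistLE_dualDist
  set a := dualDist (σ s) (ρ s)
  refine le_of_forall_pos_le_add fun ε hε => ?_
  -- The smoothing error δ(t - s) occurs once for each solution; the two sum to ε.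
  set δ := ε / (2 * (t - s)) with hδ
  obtain ⟨G, hG, hGM, hGL, hGF⟩ := h.approx δ (by positivity)
  set B : Space d → Space d := fun x => -∫ y, G (x - y) ∂(σ s : Measure (Space d)) with hB
  have hGc := hG.continuous
  have hBc : ContDiff ℝ 1 B := (contDiff_integral_sub hG hGM hGL (σ s)).neg
  have hBM : ∀ x, ‖B x‖ ≤ M := fun x => by
    rw [hB, norm_neg]
    simpa using norm_integral_le_of_norm_le_const (μ := (σ s : Measure (Space d)))
      (.of_forall fun y => hGM (x - y))
  have hBL : ∀ x, ‖fderiv ℝ B x‖ ≤ L := fun x => by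
    rw [hB, fderiv_fun_neg, norm_neg]
    exact norm_fderiv_integral_sub_le hG hGM hGL (σ s) x
  have hfield : ∀ (π : ProbabilityMeasure (Space d)) (D : ℝ), DualDistLE π (σ s) D → ∀ x,
      ‖gradConv K π x + B x‖ ≤ δ + L * D := by
    intro π D hD x
    have hi : Integrable (fun y => G (x - y)) (π : Measure (Space d)) :=
      Integrable.of_bound (Continuous.aestronglyMeasurable (by fun_prop)) M
        (.of_forall fun y => hGM _)
    have h1 : ‖gradConv K π x - ∫ y, G (x - y) ∂(π : Measure (Space d))‖ ≤ δ := by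
      rw [gradConv, ← integral_sub (h.integrable (g := fun y => x - y) (by fun_prop)) hi]
      have : ∀ y, ‖∇ K (x - y) - G (x - y)‖ ≤ δ := fun y => by
        rw [norm_sub_rev]; exact hGF _
      simpa using norm_integral_le_of_norm_le_const (μ := (π : Measure (Space d)))
        (.of_forall this)
    have h2 := hD.norm_integral_sub_le hG hGM hL hGL x
    calc ‖gradConv K π x + B x‖ = ‖(gradConv K π x - ∫ y, G (x - y) ∂(π : Measure (Space d)))
          + (∫ y, G (x - y) ∂(π : Measure (Space d))
            - ∫ y, G (x - y) ∂(σ s : Measure (Space d)))‖ := by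
          congr 1; simp only [hB]; abel
      _ ≤ δ + L * D := (norm_add_le _ _).trans (add_le_add h1 h2)
  have hself : ∀ {π : ℝ → ProbabilityMeasure (Space d)}, IsWeakSolution K T ρ₀ π →
      ∀ r ∈ Ioo s t, DualDistLE (π r) (π s) (M * (t - s)) := fun hπ r hr φ hφ =>
    ((hπ.dualDistLE_self h hs hr.1.le (hr.2.trans ht)) φ hφ).trans (by gcongr; exact hr.2.le)
  refine DualDistLE.dualDist_le fun φ hφ => ?_
  -- The same field B, frozen from σ(s), serves both solutions. With τ = t - s and a the distance at
  -- time s, the three errors are (δ + 2LMτ)τ, (δ + 2LMτ + La)τ and (1 + Lτ)a.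
  have e₁ := hσ.abs_integral_sub_transport_le h hφ hBc hBM hBL hs hst ht
    (fun r hr => hfield _ _ (hself hσ r hr))
  have e₂ := hρ.abs_integral_sub_transport_le h hφ hBc hBM hBL hs hst ht
    (fun r hr => hfield _ _ ((hself hρ r hr).triangle ha.symm))
  have e₃ := ha.abs_sub_le (hφ.comp_add_smul hBc hBL (t - s)) (by positivity)
  rw [abs_of_pos hts] at e₃
  have hδ' : δ * (t - s) = ε / 2 := by rw [hδ]; field_simp
  rw [abs_le] at e₁ e₂ e₃ ⊢
  constructor <;> nlinarith

/-- Weak solutions with the same initial datum coincide. -/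
lemma IsWeakSolution.eq (hσ : IsWeakSolution K T ρ₀ σ) (hρ : IsWeakSolution K T ρ₀ ρ)
    (h : IsRegularKernel (∇ K) M L) {t : ℝ} (ht : t ∈ Ico 0 T) : σ t = ρ t := by
  have hT := ht.1.trans_lt ht.2
  -- The distance is only known to be continuous, so Gronwall is used in its form for right
  -- difference quotients; the quadratic error of a step disappears in their limit.
  have key := le_gronwallBound_of_liminf_deriv_right_le (a := 0) (b := t) (δ := 0) (ε := 0)
    (K := 2 * L) (f := fun t => dualDist (σ t) (ρ t))
    (f' := fun t => 2 * L * dualDist (σ t) (ρ t))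
    ((hσ.continuousOn_dualDist hρ h).mono fun r hr => ⟨hr.1, hr.2.trans_lt ht.2⟩)
    (fun s hs r hr => ?_) (hσ.dualDist_zero hρ h hT) (fun s _ => by simp) t ⟨ht.1, le_rfl⟩
  · rw [gronwallBound_ε0_δ0] at key
    refine DualDistLE.eq fun φ hφ => ?_
    exact ((hσ.dualDistLE hρ h ht).dualDistLE_dualDist φ hφ).trans key
  · have hlim : Tendsto (fun z => 2 * L * dualDist (σ s) (ρ s) + 4 * L * M * (z - s)) (𝓝[>] s)
        (𝓝 (2 * L * dualDist (σ s) (ρ s))) := by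
      have : Continuous fun z => 2 * L * dualDist (σ s) (ρ s) + 4 * L * M * (z - s) := by fun_prop
      simpa using (this.tendsto s).mono_left nhdsWithin_le_nhds
    refine Eventually.frequently ?_
    filter_upwards [hlim (Iio_mem_nhds hr), Ioo_mem_nhdsGT hs.2] with z hz hzs
    have hpos := sub_pos.2 hzs.1
    have hstep := hσ.dualDist_step hρ h hs.1 hzs.1 (hzs.2.trans ht.2)
    refine lt_of_le_of_lt ?_ hz
    rw [inv_mul_le_iff₀ hpos]
    linarith

end Uniqueness

lemma MemP1.marginal {f₀ : ProbabilityMeasure (Space d × Space d)} (hf₀ : MemP1 f₀) :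
    MemP1 (ZeroInertia.marginal f₀) := by
  unfold MemP1 at *
  rw [toMeasure_marginal, lintegral_map measurable_enorm measurable_fst]
  exact (lintegral_mono fun z => enorm_le_iff_norm_le.2 (norm_fst_le z)).trans_lt hf₀

lemma continuous_gradient (hK : ContDiff ℝ 1 K) : Continuous (∇ K) :=
  (LinearIsometryEquiv.continuous _).comp (hK.continuous_fderiv one_ne_zero)

end ZeroInertia

end

theorem mainTheorem1 {d : ℕ} (T : ℝ) (hT : 0 < T)
    (K : Space d → ℝ) (hK : ContDiff ℝ 1 K) (hK' : MemW1Infty (∇ K))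
    (f₀ : ProbabilityMeasure (Space d × Space d)) (hf₀ : MemP1 f₀)
    (hsupp : IsCompact (f₀ : Measure (Space d × Space d)).support)
    (f : ℝ → ℝ → ProbabilityMeasure (Space d × Space d))
    (hf : ∀ ε : ℝ, 0 < ε → IsMeasureSolution K ε T f₀ (f ε)) :
    ∃ ρ : ℝ → ProbabilityMeasure (Space d),
      ContinuousInP1 T ρ ∧
      (∀ t ∈ Ico 0 T, Tendsto (fun ε => W1 (marginal (f ε t)) (ρ t)) (𝓝[>] 0) (𝓝 0)) ∧
      IsWeakSolution K T (marginal f₀) ρ ∧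
      ∀ σ : ℝ → ProbabilityMeasure (Space d), IsWeakSolution K T (marginal f₀) σ →
        ∀ t ∈ Ico 0 T, σ t = ρ t := by
  obtain ⟨M, L, h⟩ := hK'.exists_isRegularKernel (continuous_gradient hK)
  obtain ⟨X, ρ, hX⟩ := exists_isMeanFieldFlow h hT (marginal f₀)
  have hρ := hX.isWeakSolution h hT
  exact ⟨ρ, hX.continuousInP1 h hf₀.marginal, fun t ht => tendsto_W1_marginal h hsupp hf hX ht, hρ,
    fun σ hσ t ht => hσ.eq hρ h ht⟩
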